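/- **Theorem.** Let $m>0$ and let $V\in L^1(\mathbb R)$ be real-valued. Let $H=-\partial_t^2+V(t)$ be the self-adjoint operator on $L^2(\mathbb R)$ with domain $\{u\in L^2 : u,u' \text{ locally absolutely continuous},\ -u''+Vu\in L^2\}$, and consider the $1+0$-dimensional Klein–Gordon operator $K=-H+m^2=\partial_t^2-V(t)+m^2$. Write $\mathcal W(\psi_1,\psi_2)=\psi_1\psi_2'-\psi_1'\psi_2$. *Jost solutions.* For $k=\pm \mathrm i m$ there are unique solutions $\psi_+(k,\cdot)$, $\psi_-(k,\cdot)$ of $(H+k^2)\psi=0$ with $\psi_\pm(k,t)\sim e^{\mp kt}$ as $t\to\pm\infty$, and there are unique numbers $A(k),B(k)\in\mathbb C$ with $$\psi_+(k,t)=A(k)\,\psi_-(-k,t)+B(k)\,\psi_+(-k,t)\qquad(t\in\mathbb R).$$ The potential is called *reflectionless at energy $m^2$* if $B(\mathrm i m)=B(-\mathrm i m)=0$. *Green functions.* The function $$G^{\leftrightarrow}(m^2;t,s)=\frac{\psi_1(t)\psi_2(s)-\psi_2(t)\psi_1(s)}{\mathcal W(\psi_1,\psi_2)},$$ where $\psi_1,\psi_2$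 are solutions of $(H-m^2)\psi=0$ with $\mathcal W(\psi_1,\psi_2)\ne0$, exists and does not depend on the choice of $\psi_1,\psi_2$. With $\theta$ the Heaviside function, the forward and backward Green functions are $$G^{\rightarrow}(m^2;t,s)=\theta(t-s)\,G^{\leftrightarrow}(m^2;t,s),\qquad G^{\leftarrow}(m^2;t,s)=-\theta(s-t)\,G^{\leftrightarrow}(m^2;t,s).$$ For $z\in\mathbb C\setminus\mathbb R$ let $G(z;t,s)$ be the integral kernel of the resolvent $(H-z)^{-1}$. The limits $$G(m^2\mp \mathrm i0)=\lim_{\varepsilon\searrow0}G(m^2\mp \mathrm i\varepsilon;\cdot,\cdot)$$ exist in the sense of distributions on $\mathbb R\times\mathbb R$. The Klein–Gordon equation is called *special* if $$G(m^2-\mathrm i0)+G(m^2+\mathrm i0)=G^{\rightarrow}(m^2)+G^{\leftarrow}(m^2)$$ as distributions on $\mathbb R\times\mathbb R$. Then the potential is reflectionless at energy $m^2$ if and only if the Klein–Gordon equation is special. -/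

import Mathlib

open MeasureTheory Filter Topology Asymptotics TopologicalSpace
open scoped Distributions

noncomputable section

namespace KleinGordon1D

/-- The Hilbert space `L²(ℝ)` of complex valued functions. -/
abbrev L2 : Type := Lp ℂ 2 (volume : Measure ℝ)

/-! ### Solutions of `(H - z) ψ = 0`, where `H = -∂ₜ² + V(t)` -/

/-- `ψ` solves `-ψ'' + V ψ = z ψ` on `ℝ` in the Carathéodory sense: `ψ` is differentiable, `ψ'` is
locally absolutely continuous and `ψ'' = (V - z) ψ` almost everywhere (written in integrated form,
since `V` need not be continuous). -/
def IsSolution (V : ℝ → ℝ) (z : ℂ) (ψ : ℝ → ℂ) : Prop :=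
  Differentiable ℝ ψ ∧
    ∀ a b : ℝ, deriv ψ b - deriv ψ a = ∫ t in a..b, ((V t : ℂ) - z) * ψ t

/-- The Wronskian `ψ₁ ψ₂' - ψ₁' ψ₂`. -/
def wronskian (ψ₁ ψ₂ : ℝ → ℂ) (t : ℝ) : ℂ :=
  ψ₁ t * deriv ψ₂ t - deriv ψ₁ t * ψ₂ t

/-! ### The canonical bisolution, the forward and the backward Green function -/

/-- `G(t,s) = (ψ₁(t) ψ₂(s) - ψ₂(t) ψ₁(s)) / W(ψ₁,ψ₂)` for some pair of solutions of
`(H - z) ψ = 0` with non-zero (constant) Wronskian. -/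
def IsCanonicalBisolution (V : ℝ → ℝ) (z : ℂ) (G : ℝ → ℝ → ℂ) : Prop :=
  ∃ (ψ₁ ψ₂ : ℝ → ℂ) (w : ℂ), IsSolution V z ψ₁ ∧ IsSolution V z ψ₂ ∧ w ≠ 0 ∧
    (∀ t, wronskian ψ₁ ψ₂ t = w) ∧
    ∀ t s, G t s = (ψ₁ t * ψ₂ s - ψ₂ t * ψ₁ s) / w

/-- The canonical bisolution `G^↔(z; t, s)`. -/
def canonicalBisolution (V : ℝ → ℝ) (z : ℂ) : ℝ → ℝ → ℂ :=
  Classical.epsilon (IsCanonicalBisolution V z)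

/-- The Heaviside function. -/
def heaviside (x : ℝ) : ℂ := if 0 ≤ x then 1 else 0

/-- The forward Green function `G^→(z; t, s) = θ(t - s) G^↔(z; t, s)`. -/
def forwardGreen (V : ℝ → ℝ) (z : ℂ) (t s : ℝ) : ℂ :=
  heaviside (t - s) * canonicalBisolution V z t s

/-- The backward Green function `G^←(z; t, s) = -θ(s - t) G^↔(z; t, s)`. -/
def backwardGreen (V : ℝ → ℝ) (z : ℂ) (t s : ℝ) : ℂ :=
  -(heaviside (s - t) * canonicalBisolution V z t s)

/-! ### Jost solutions and reflectionlessness -/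

/-- `ψ` solves `(H + k²) ψ = 0` and `ψ(t) ∼ exp(-k t)` as `t → +∞`. -/
def IsJostPlus (V : ℝ → ℝ) (k : ℂ) (ψ : ℝ → ℂ) : Prop :=
  IsSolution V (-k ^ 2) ψ ∧ ψ ~[atTop] fun t : ℝ => Complex.exp (-k * t)

/-- `ψ` solves `(H + k²) ψ = 0` and `ψ(t) ∼ exp(k t)` as `t → -∞`. -/
def IsJostMinus (V : ℝ → ℝ) (k : ℂ) (ψ : ℝ → ℂ) : Prop :=
  IsSolution V (-k ^ 2) ψ ∧ ψ ~[atBot] fun t : ℝ => Complex.exp (k * t)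

/-- The Jost solution `ψ₊(k, ·)`. -/
def jostPlus (V : ℝ → ℝ) (k : ℂ) : ℝ → ℂ := Classical.epsilon (IsJostPlus V k)

/-- The Jost solution `ψ₋(k, ·)`. -/
def jostMinus (V : ℝ → ℝ) (k : ℂ) : ℝ → ℂ := Classical.epsilon (IsJostMinus V k)

/-- The pair `p = (A, B)` satisfies `ψ₊(k, t) = A ψ₋(-k, t) + B ψ₊(-k, t)` for all `t`. -/
def IsScatteringPair (V : ℝ → ℝ) (k : ℂ) (p : ℂ × ℂ) : Prop :=
  ∀ t, jostPlus V k t = p.1 * jostMinus V (-k) t + p.2 * jostPlus V (-k) t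

/-- The coefficient `B(k)`. -/
def scatteringB (V : ℝ → ℝ) (k : ℂ) : ℂ := (Classical.epsilon (IsScatteringPair V k)).2

/-- The potential is reflectionless at energy `m²`: `B(i m) = 0` and `B(-i m) = 0`. -/
def IsReflectionless (V : ℝ → ℝ) (m : ℝ) : Prop :=
  scatteringB V (Complex.I * m) = 0 ∧ scatteringB V (-(Complex.I * m)) = 0

/-! ### The operator `H` on `L²(ℝ)`, its resolvent, and the boundary values of the resolvent -/

/-- `u` lies in the domain of the self-adjoint operator `H = -∂ₜ² + V` on `L²(ℝ)`, and `H u = w`.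
The domain consists of all `u ∈ L²` that are (represented by) a differentiable function `f` with
`f'` locally absolutely continuous and `-f'' + V f ∈ L²`; here `-f'' + V f = w` is written in
integrated form. -/
def IsSchrodinger (V : ℝ → ℝ) (u w : L2) : Prop :=
  ∃ f : ℝ → ℂ, (u : ℝ → ℂ) =ᵐ[volume] f ∧ Differentiable ℝ f ∧
    ∀ a b : ℝ, deriv f b - deriv f a = ∫ t in a..b, ((V t : ℂ) * f t - (w : ℝ → ℂ) t)

/-- `R` is the resolvent `(H - z)⁻¹`: `R g = u` if and only if `u` lies in the domain of `H` and
`H u = z u + g`. -/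
def IsResolvent (V : ℝ → ℝ) (z : ℂ) (R : L2 →L[ℂ] L2) : Prop :=
  ∀ g u : L2, R g = u ↔ IsSchrodinger V u (z • u + g)

/-- The locally integrable function `K` on `ℝ × ℝ` is the integral kernel `G(z; t, s)` of the
resolvent `(H - z)⁻¹`. -/
def IsResolventKernel (V : ℝ → ℝ) (z : ℂ) (K : ℝ × ℝ → ℂ) : Prop :=
  LocallyIntegrable K volume ∧
    ∃ R : L2 →L[ℂ] L2, IsResolvent V z R ∧
      ∀ g : L2, ∀ᵐ t ∂(volume : Measure ℝ),
        Integrable (fun s => K (t, s) * (g : ℝ → ℂ) s) volume ∧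
          (R g : ℝ → ℂ) t = ∫ s, K (t, s) * (g : ℝ → ℂ) s

/-- Complex distributions on `ℝ × ℝ`. -/
abbrev Distrib2 : Type := 𝓓'((⊤ : Opens (ℝ × ℝ)), ℂ)

/-- The distribution `T` on `ℝ × ℝ` is given by the locally integrable function `F`. -/
def IsGivenBy (T : Distrib2) (F : ℝ × ℝ → ℂ) : Prop :=
  LocallyIntegrable F volume ∧
    ∀ φ : 𝓓((⊤ : Opens (ℝ × ℝ)), ℝ), T φ = ∫ p : ℝ × ℝ, (φ p : ℂ) * F p

/-- `T` is the distributional limit, as `ε ↘ 0`, of the resolvent kernels `G(E + i σ ε; t, s)`.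
For `σ = 1` this is `G(E + i0)`, for `σ = -1` it is `G(E - i0)`. -/
def IsBoundaryValue (V : ℝ → ℝ) (E σ : ℝ) (T : Distrib2) : Prop :=
  ∃ K : ℝ → ℝ × ℝ → ℂ,
    (∀ ε : ℝ, 0 < ε → IsResolventKernel V (E + Complex.I * σ * ε) (K ε)) ∧
      ∀ φ : 𝓓((⊤ : Opens (ℝ × ℝ)), ℝ),
        Tendsto (fun ε : ℝ => ∫ p : ℝ × ℝ, (φ p : ℂ) * K ε p) (𝓝[>] 0) (𝓝 (T φ))

/-- The boundary value `G(E + i0)` (for `σ = 1`) or `G(E - i0)` (for `σ = -1`). -/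
def boundaryValue (V : ℝ → ℝ) (E σ : ℝ) : Distrib2 :=
  Classical.epsilon (IsBoundaryValue V E σ)

/-- The Klein-Gordon equation given by `K = -H + m² = ∂ₜ² - V(t) + m²` is special:
`G(m² - i0) + G(m² + i0) = G^→(m²) + G^←(m²)` as distributions on `ℝ × ℝ`. -/
def IsSpecial (V : ℝ → ℝ) (m : ℝ) : Prop :=
  IsGivenBy (boundaryValue V (m ^ 2) (-1) + boundaryValue V (m ^ 2) 1)
    fun p => forwardGreen V ((m : ℂ) ^ 2) p.1 p.2 + backwardGreen V ((m : ℂ) ^ 2) p.1 p.2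

end KleinGordon1D

end

noncomputable section

namespace KleinGordon1D

/-! ### Primitives of locally integrable functions -/

/-! Put k = i m and write P, P' for the Jost solutions at +∞ with parameters k, -k, and Q, Q' for
those at -∞. With x = max(t,s) and y = min(t,s), the boundary values G(m² - i0) and G(m² + i0) have
the continuous kernels P(x)Q(y)/W(P,Q) and P'(x)Q'(y)/W(P',Q'). Since W(P,P') = 2k, the pair P, P'
is a basis of solutions. Expanding Q and Q' in it gives the sum of the two kernels as (P(x)P'(y) -
P'(x)P(y))/(2k) + (a P(x)P(y) + b P'(x)P'(y))/(2k), where a = W(Q,P')/W(P,Q) and b =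
W(P,Q')/W(P',Q'). The first term is the canonical bisolution at (x,y), which by antisymmetry equals
the forward plus the backward Green function. So the equation is special iff the second term
vanishes identically, that is iff a = b = 0. By Cramer's rule these vanish exactly when B(-k) and
B(k) do. This algebra is `greenKernel_add_eq_iff`.

The analysis justifies the two kernels. For Re k ≥ 0 and k ≠ 0 a Volterra series constructs
exp(kt)ψ₊(k,t), with bounds uniform in |k| ≥ δ and continuity in k up to the imaginary axis
(`continuousOn_jostFactor`). The sign of Im(ψ' ψ̄) shows that Jost solutions have no zeros and that
W(ψ₊,ψ₋) ≠ 0 when Im k ≠ 0 (`wronskian_jostSol_jostSolMinus_ne_zero`). For Re k > 0 and Im k ≠ 0 the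
Green kernel decays exponentially off the diagonal and gives the resolvent
(`isResolventKernel_greenKernel`). Dominated convergence then reaches the imaginary axis
(`isBoundaryValue_iff`).

Because V is only integrable, second derivatives exist only almost everywhere. All differential
identities are therefore handled through primitives of locally integrable functions. -/

/-- `F` is a primitive of the locally integrable function `f`. -/
structure IsPrimitive (F f : ℝ → ℂ) : Prop where
  locallyIntegrable : LocallyIntegrable f volume
  sub_eq : ∀ a b : ℝ, F b - F a = ∫ x in a..b, f x

theorem _root_.MeasureTheory.LocallyIntegrable.intervalIntegrable_real {f : ℝ → ℂ}
    (hf : LocallyIntegrable f volume) (a b : ℝ) : IntervalIntegrable f volume a b :=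
  intervalIntegrable_iff.mpr <|
    (hf.integrableOn_isCompact isCompact_uIcc).mono_set Set.uIoc_subset_uIcc

theorem LocallyIntegrable.mul_continuous {f g : ℝ → ℂ} (hf : LocallyIntegrable f volume)
    (hg : Continuous g) : LocallyIntegrable (fun x => f x * g x) volume := by
  rw [locallyIntegrable_iff] at hf ⊢
  exact fun K hK => (hf K hK).mul_continuousOn hg.continuousOn hK

theorem LocallyIntegrable.continuous_mul {f g : ℝ → ℂ} (hf : LocallyIntegrable f volume)
    (hg : Continuous g) : LocallyIntegrable (fun x => g x * f x) volume := by
  simpa only [mul_comm] using LocallyIntegrable.mul_continuous hf hg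

namespace IsPrimitive

variable {F G f g : ℝ → ℂ}

theorem intervalIntegrable (h : IsPrimitive F f) (a b : ℝ) : IntervalIntegrable f volume a b :=
  h.locallyIntegrable.intervalIntegrable_real a b

theorem eq_integral (h : IsPrimitive F f) (a t : ℝ) : F t = F a + ∫ x in a..t, f x := by
  rw [← h.sub_eq a t]; ring

protected theorem continuous (h : IsPrimitive F f) : Continuous F := by
  have : F = fun t => F 0 + ∫ x in (0 : ℝ)..t, f x := funext fun t => h.eq_integral 0 t
  rw [this]
  exact continuous_const.add
    (intervalIntegral.continuous_primitive (fun a b => h.intervalIntegrable a b) 0)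

theorem ae_hasDerivAt (h : IsPrimitive F f) : ∀ᵐ x, HasDerivAt F (f x) x := by
  have : F = fun t => F 0 + ∫ x in (0 : ℝ)..t, f x := funext fun t => h.eq_integral 0 t
  filter_upwards [LocallyIntegrable.ae_hasDerivAt_integral h.locallyIntegrable] with x hx
  rw [this]
  exact (hx 0).const_add _

/-- Each increment of F is dominated by the corresponding increment of the primitive of ‖f‖, which
is absolutely continuous. -/
theorem absolutelyContinuousOnInterval (h : IsPrimitive F f) (a b : ℝ) :
    AbsolutelyContinuousOnInterval F a b := by
  have hn := (h.intervalIntegrable a b).norm.absolutelyContinuousOnInterval_intervalIntegral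
    (c := a) (by simp)
  have hi : ∀ x y, IntervalIntegrable (fun t => ‖f t‖) volume x y :=
    fun x y => (h.intervalIntegrable x y).norm
  refine squeeze_zero (fun t => ?_) (fun t => ?_) hn
  · exact Finset.sum_nonneg (fun i _ => by positivity)
  · refine Finset.sum_le_sum fun i _ => ?_
    rw [dist_comm (F _), dist_comm (∫ v in a..(t.2 i).1, ‖f v‖), dist_eq_norm, h.sub_eq,
      Real.dist_eq, intervalIntegral.integral_interval_sub_left (hi _ _) (hi _ _)]
    exact intervalIntegral.norm_integral_le_abs_integral_norm

theorem const (c : ℂ) : IsPrimitive (fun _ => c) (fun _ => 0) :=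
  ⟨locallyIntegrable_zero, fun a b => by simp⟩

theorem congr_ae (h : IsPrimitive F f) (hfg : f =ᵐ[volume] g) : IsPrimitive F g :=
  ⟨(locallyIntegrable_congr hfg).1 h.locallyIntegrable, fun a b => by
    rw [h.sub_eq, intervalIntegral.integral_congr_ae (hfg.mono fun x hx _ => hx)]⟩

theorem congr (h : IsPrimitive F f) (hF : ∀ t, F t = G t) (hf : ∀ t, f t = g t) :
    IsPrimitive G g := by
  obtain rfl := funext hF
  obtain rfl := funext hf
  exact h

theorem add (hF : IsPrimitive F f) (hG : IsPrimitive G g) :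
    IsPrimitive (fun t => F t + G t) (fun t => f t + g t) :=
  ⟨hF.locallyIntegrable.add hG.locallyIntegrable, fun a b => by
    rw [intervalIntegral.integral_add (hF.intervalIntegrable a b) (hG.intervalIntegrable a b),
      ← hF.sub_eq, ← hG.sub_eq]; ring⟩

theorem const_mul (hF : IsPrimitive F f) (c : ℂ) :
    IsPrimitive (fun t => c * F t) (fun t => c * f t) :=
  ⟨LocallyIntegrable.continuous_mul hF.locallyIntegrable continuous_const, fun a b => by
    rw [intervalIntegral.integral_const_mul, ← hF.sub_eq]; ring⟩

theorem neg (hF : IsPrimitive F f) : IsPrimitive (fun t => -F t) (fun t => -f t) :=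
  (hF.const_mul (-1)).congr (fun _ => by ring) (fun _ => by ring)

theorem sub (hF : IsPrimitive F f) (hG : IsPrimitive G g) :
    IsPrimitive (fun t => F t - G t) (fun t => f t - g t) :=
  (hF.add hG.neg).congr (fun _ => by ring) (fun _ => by ring)

theorem of_integral (hf : LocallyIntegrable f volume) (a : ℝ) :
    IsPrimitive (fun t => ∫ x in a..t, f x) f :=
  ⟨hf, fun _ _ => intervalIntegral.integral_interval_sub_left
    (hf.intervalIntegrable_real _ _) (hf.intervalIntegrable_real _ _)⟩

/-- F G minus the integral of the expected derivative is absolutely continuous with derivative zero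
almost everywhere, hence constant. This takes the place of every later integration by parts. -/
theorem mul (hF : IsPrimitive F f) (hG : IsPrimitive G g) :
    IsPrimitive (fun t => F t * G t) (fun t => f t * G t + F t * g t) := by
  have hloc : LocallyIntegrable (fun t => f t * G t + F t * g t) volume :=
    (LocallyIntegrable.mul_continuous hF.locallyIntegrable hG.continuous).add
      (LocallyIntegrable.continuous_mul hG.locallyIntegrable hF.continuous)
  refine ⟨hloc, fun a b => ?_⟩
  have hI := IsPrimitive.of_integral hloc a
  have hac := ((hF.absolutelyContinuousOnInterval a b).fun_smul
    (hG.absolutelyContinuousOnInterval a b)).sub (hI.absolutelyContinuousOnInterval a b)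
  obtain ⟨C, hC⟩ := hac.const_of_ae_hasDerivAt_zero (by
    filter_upwards [hF.ae_hasDerivAt, hG.ae_hasDerivAt, hI.ae_hasDerivAt] with x h1 h2 h3 _
    have := (h1.mul h2).sub h3
    rw [sub_self] at this
    exact this)
  have ha := hC a (by simp)
  have hb := hC b (by simp)
  simp only [Pi.sub_apply, smul_eq_mul, intervalIntegral.integral_same, sub_zero] at ha hb
  rw [ha, sub_eq_iff_eq_add.1 hb]; ring

theorem of_hasDerivAt (h : ∀ x, HasDerivAt F (f x) x) (hf : Continuous f) : IsPrimitive F f :=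
  ⟨hf.locallyIntegrable, fun a b => (intervalIntegral.integral_eq_sub_of_hasDerivAt
    (fun x _ => h x) (hf.intervalIntegrable a b)).symm⟩

theorem hasDerivAt (h : IsPrimitive F f) (hf : Continuous f) (x : ℝ) : HasDerivAt F (f x) x := by
  have : F = fun t => F 0 + ∫ x in (0 : ℝ)..t, f x := funext fun t => h.eq_integral 0 t
  rw [this]
  exact (intervalIntegral.integral_hasDerivAt_right (hf.intervalIntegrable _ _)
    (hf.stronglyMeasurableAtFilter _ _) hf.continuousAt).const_add _

theorem eq_of_eq_zero (h : IsPrimitive F f) (hf : ∀ t, f t = 0) (a b : ℝ) : F a = F b := by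
  have := h.sub_eq b a
  simp only [hf, intervalIntegral.integral_zero] at this
  exact sub_eq_zero.1 this

theorem setIntegral_Ioi (hf : LocallyIntegrable f volume)
    (hfi : ∀ t, IntegrableOn f (Set.Ioi t) volume) :
    IsPrimitive (fun t => ∫ s in Set.Ioi t, f s) (fun t => -f t) := by
  refine ⟨hf.neg, fun a b => ?_⟩
  rw [intervalIntegral.integral_neg, ← intervalIntegral.integral_Ioi_sub_Ioi' (hfi a) (hfi b)]
  ring

theorem setIntegral_Iic (hf : LocallyIntegrable f volume)
    (hfi : ∀ t, IntegrableOn f (Set.Iic t) volume) :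
    IsPrimitive (fun t => ∫ s in Set.Iic t, f s) f :=
  ⟨hf, fun a b => intervalIntegral.integral_Iic_sub_Iic (hfi a) (hfi b)⟩

end IsPrimitive

theorem isPrimitive_exp (c : ℂ) :
    IsPrimitive (fun t : ℝ => Complex.exp (c * t)) (fun t => c * Complex.exp (c * t)) := by
  refine IsPrimitive.of_hasDerivAt (fun x => ?_) (by fun_prop)
  have h := ((hasDerivAt_id (x : ℂ)).const_mul c).cexp.comp_ofReal
  simpa [mul_comm] using h

/-! ### Solutions -/

section Solutions

variable {V : ℝ → ℝ} {z : ℂ} {ψ φ u χ : ℝ → ℂ}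

theorem IsSolution.of_isPrimitive (h1 : IsPrimitive ψ χ)
    (h2 : IsPrimitive χ fun t => ((V t : ℂ) - z) * ψ t) : IsSolution V z ψ ∧ deriv ψ = χ := by
  have hd : deriv ψ = χ := funext fun x => (h1.hasDerivAt h2.continuous x).deriv
  exact ⟨⟨fun x => (h1.hasDerivAt h2.continuous x).differentiableAt, hd ▸ h2.sub_eq⟩, hd⟩

theorem locallyIntegrable_sub_mul (hV : LocallyIntegrable V volume) (hψ : Continuous ψ) :
    LocallyIntegrable (fun t => ((V t : ℂ) - z) * ψ t) volume := by
  refine LocallyIntegrable.mul_continuous (LocallyIntegrable.sub ?_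
    (continuous_const.locallyIntegrable)) hψ
  rw [locallyIntegrable_iff] at hV ⊢
  exact fun K hK => (hV K hK).ofReal

theorem isPrimitive_deriv_of_sub_eq {w : ℝ → ℂ} (hψ : Differentiable ℝ ψ)
    (hw : LocallyIntegrable w volume)
    (h : ∀ a b : ℝ, deriv ψ b - deriv ψ a = ∫ t in a..b, w t) :
    IsPrimitive ψ (deriv ψ) ∧ IsPrimitive (deriv ψ) w := by
  have h2 : IsPrimitive (deriv ψ) w := ⟨hw, h⟩
  exact ⟨IsPrimitive.of_hasDerivAt (fun x => (hψ x).hasDerivAt) h2.continuous, h2⟩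

theorem IsSolution.isPrimitive (hV : LocallyIntegrable V volume) (h : IsSolution V z ψ) :
    IsPrimitive ψ (deriv ψ) ∧ IsPrimitive (deriv ψ) fun t => ((V t : ℂ) - z) * ψ t :=
  isPrimitive_deriv_of_sub_eq h.1 (locallyIntegrable_sub_mul hV h.1.continuous) h.2

theorem IsSolution.wronskian_eq (hV : LocallyIntegrable V volume) (hψ : IsSolution V z ψ)
    (hφ : IsSolution V z φ) (a b : ℝ) : wronskian ψ φ a = wronskian ψ φ b := by
  obtain ⟨p1, p2⟩ := hψ.isPrimitive hV
  obtain ⟨q1, q2⟩ := hφ.isPrimitive hV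
  exact ((p1.mul q2).sub (p2.mul q1)).eq_of_eq_zero (fun t => by ring) a b

theorem wronskian_swap (ψ φ : ℝ → ℂ) (t : ℝ) : wronskian φ ψ t = -wronskian ψ φ t := by
  simp only [wronskian]; ring

/-- Expansion of the determinant with rows (u, ψ, φ), (u, ψ, φ), (u', ψ', φ'), which is zero because
of the repeated row. Once the Wronskians are constant, this is Cramer's rule for solutions. -/
theorem mul_wronskian (u ψ φ : ℝ → ℂ) (t : ℝ) :
    u t * wronskian ψ φ t = ψ t * wronskian u φ t + φ t * wronskian ψ u t := by
  simp only [wronskian]; ring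

/-- A solution is a linear combination of two solutions with non-zero Wronskian. -/
theorem IsSolution.eq_combination (hV : LocallyIntegrable V volume) (hu : IsSolution V z u)
    (hψ : IsSolution V z ψ) (hφ : IsSolution V z φ) (hW : wronskian ψ φ 0 ≠ 0) (t : ℝ) :
    u t = wronskian u φ 0 / wronskian ψ φ 0 * ψ t + wronskian ψ u 0 / wronskian ψ φ 0 * φ t := by
  have := mul_wronskian u ψ φ t
  rw [hψ.wronskian_eq hV hφ t 0, hu.wronskian_eq hV hφ t 0, hψ.wronskian_eq hV hu t 0] at this
  field_simp
  linear_combination this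

theorem wronskian_combination (hψ : Differentiable ℝ ψ) (hφ : Differentiable ℝ φ) {p q : ℝ → ℂ}
    {a b c d : ℂ} (hp : ∀ t, p t = a * ψ t + b * φ t) (hq : ∀ t, q t = c * ψ t + d * φ t)
    (t : ℝ) : wronskian p q t = (a * d - b * c) * wronskian ψ φ t := by
  have hd : ∀ {r : ℝ → ℂ} {a b : ℂ}, (∀ t, r t = a * ψ t + b * φ t) →
      deriv r t = a * deriv ψ t + b * deriv φ t := by
    intro r a b hr
    rw [funext hr]
    exact (((hψ t).hasDerivAt.const_mul a).add ((hφ t).hasDerivAt.const_mul b)).deriv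
  simp only [wronskian, hd hp, hd hq, hp t, hq t]; ring

/-- Time reflection carries everything proved at +∞ over to -∞. -/
theorem IsSolution.comp_neg (h : IsSolution V z ψ) :
    IsSolution (fun t => V (-t)) z (fun t => ψ (-t)) := by
  refine ⟨h.1.comp differentiable_neg, fun a b => ?_⟩
  have := h.2 (-b) (-a)
  simp only [deriv_comp_neg]
  rw [intervalIntegral.integral_comp_neg (fun t => ((V t : ℂ) - z) * ψ t), ← this]; ring

theorem wronskian_comp_neg (ψ φ : ℝ → ℂ) (t : ℝ) :
    wronskian (fun t => ψ (-t)) (fun t => φ (-t)) t = -wronskian ψ φ (-t) := by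
  simp only [wronskian, deriv_comp_neg]; ring

end Solutions

/-! ### The Volterra series for the Jost solution at `+∞` -/

theorem tendsto_setIntegral_Ioi_atTop {E : Type*} [NormedAddCommGroup E] [NormedSpace ℝ E]
    {f : ℝ → E} (hf : Integrable f volume) :
    Tendsto (fun t : ℝ => ∫ s in Set.Ioi t, f s) atTop (𝓝 0) := by
  have h := intervalIntegral_tendsto_integral_Ioi (0 : ℝ) hf.integrableOn tendsto_id
  have h2 := (tendsto_const_nhds (x := ∫ s in Set.Ioi (0 : ℝ), f s)).sub h
  rw [sub_self] at h2
  refine h2.congr fun t => ?_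
  rw [id, ← intervalIntegral.integral_Ioi_sub_Ioi' hf.integrableOn hf.integrableOn]
  abel

/-- The tail `∫_t^∞ |V|`. -/
def tailNorm (V : ℝ → ℝ) (t : ℝ) : ℝ := ∫ s in Set.Ioi t, |V s|

/-- The kernel `(1 - exp(-2 k x)) / (2 k)` for `x ≥ 0`, extended by zero. -/
def volterraKernel (k : ℂ) (x : ℝ) : ℂ :=
  (1 - Complex.exp (-2 * k * (max x 0 : ℝ))) / (2 * k)

/-- The terms of the Volterra series of `exp(k t) ψ₊(k, t)`. -/
def jostTerm (V : ℝ → ℝ) (k : ℂ) : ℕ → ℝ → ℂ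
  | 0 => fun _ => 1
  | n + 1 => fun t => ∫ s, volterraKernel k (s - t) * (V s * jostTerm V k n s)

/-- The function `exp(k t) ψ₊(k, t)`. -/
def jostFactor (V : ℝ → ℝ) (k : ℂ) (t : ℝ) : ℂ := ∑' n, jostTerm V k n t

/-- A bound for `exp(k t) ψ₊(k, t)` that is uniform in `‖k‖ ≥ δ`. -/
def jostBound (V : ℝ → ℝ) (δ : ℝ) : ℝ :=
  ∑' n : ℕ, ((∫ s, |V s|) / δ) ^ n / (n.factorial : ℝ)

variable {V : ℝ → ℝ}

/-! ### Tail integrals of |V| and factorial bounds -/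

theorem tailNorm_nonneg (V : ℝ → ℝ) (t : ℝ) : 0 ≤ tailNorm V t :=
  integral_nonneg fun _ => abs_nonneg _

theorem tailNorm_le (hV : Integrable V volume) (t : ℝ) : tailNorm V t ≤ ∫ s, |V s| :=
  setIntegral_le_integral hV.abs (Eventually.of_forall fun _ => abs_nonneg _)

theorem tendsto_tailNorm (hV : Integrable V volume) : Tendsto (tailNorm V) atTop (𝓝 0) :=
  tendsto_setIntegral_Ioi_atTop hV.abs

theorem isPrimitive_tailNorm (hV : Integrable V volume) :
    IsPrimitive (fun t => (tailNorm V t : ℂ)) (fun t => -((|V t| : ℝ) : ℂ)) := by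
  have hi : Integrable (fun t => ((|V t| : ℝ) : ℂ)) volume := hV.abs.ofReal
  refine (IsPrimitive.setIntegral_Ioi hi.locallyIntegrable fun t => hi.integrableOn).congr
    (fun t => ?_) fun t => rfl
  exact integral_ofReal

theorem continuous_tailNorm (hV : Integrable V volume) : Continuous (tailNorm V) := by
  simpa [Function.comp_def] using Complex.continuous_re.comp (isPrimitive_tailNorm hV).continuous

theorem isPrimitive_tailNorm_pow (hV : Integrable V volume) (n : ℕ) :
    IsPrimitive (fun t => (tailNorm V t : ℂ) ^ (n + 1))
      (fun t => -((n + 1 : ℂ) * (((|V t| * tailNorm V t ^ n : ℝ)) : ℂ))) := by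
  induction n with
  | zero => exact (isPrimitive_tailNorm hV).congr (fun t => by simp) (fun t => by simp)
  | succ n ih =>
    refine (ih.mul (isPrimitive_tailNorm hV)).congr (fun t => by ring) (fun t => ?_)
    push_cast; ring

theorem integrable_abs_mul_tailNorm_pow (hV : Integrable V volume) (n : ℕ) :
    Integrable (fun s => |V s| * tailNorm V s ^ n) volume := by
  refine hV.abs.mul_bdd (c := (∫ s, |V s|) ^ n)
    ((continuous_tailNorm hV).pow n).aestronglyMeasurable (Eventually.of_forall fun s => ?_)
  rw [norm_pow, Real.norm_of_nonneg (tailNorm_nonneg V s)]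
  gcongr
  · exact tailNorm_nonneg V s
  · exact tailNorm_le hV s

/-- After multiplication by n + 1 both sides have the same derivative and tend to 0 at +∞. This
identity is the source of the factorials. -/
theorem setIntegral_abs_mul_tailNorm_pow (hV : Integrable V volume) (n : ℕ) (t : ℝ) :
    ∫ s in Set.Ioi t, |V s| * tailNorm V s ^ n = tailNorm V t ^ (n + 1) / (n + 1) := by
  have hi : Integrable (fun s => ((|V s| * tailNorm V s ^ n : ℝ) : ℂ)) volume :=
    (integrable_abs_mul_tailNorm_pow hV n).ofReal
  have h1 := IsPrimitive.setIntegral_Ioi hi.locallyIntegrable fun t => hi.integrableOn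
  have h2 := (h1.const_mul (n + 1)).sub (isPrimitive_tailNorm_pow hV n)
  have hc := h2.eq_of_eq_zero (fun t => by ring) t
  have hlim : Tendsto (fun t => ((n : ℂ) + 1) * (∫ s in Set.Ioi t,
      ((|V s| * tailNorm V s ^ n : ℝ) : ℂ)) - (tailNorm V t : ℂ) ^ (n + 1)) atTop (𝓝 0) := by
    have a1 := (tendsto_setIntegral_Ioi_atTop hi).const_mul ((n : ℂ) + 1)
    have a2 := ((Complex.continuous_ofReal.tendsto 0).comp (tendsto_tailNorm hV)).pow (n + 1)
    simpa using a1.sub a2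
  have h0 := tendsto_nhds_unique
    (tendsto_const_nhds.congr fun x => hc x) hlim
  have hre : ∫ s in Set.Ioi t, ((|V s| * tailNorm V s ^ n : ℝ) : ℂ) =
      ((∫ s in Set.Ioi t, |V s| * tailNorm V s ^ n : ℝ) : ℂ) := integral_ofReal
  rw [hre] at h0
  have h0' : ((n : ℝ) + 1) * (∫ s in Set.Ioi t, |V s| * tailNorm V s ^ n)
      - tailNorm V t ^ (n + 1) = 0 := by exact_mod_cast h0
  field_simp
  linarith

theorem norm_exp_neg_mul_le_one {k : ℂ} (hk : 0 ≤ k.re) {x : ℝ} (hx : 0 ≤ x) :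
    ‖Complex.exp (-2 * k * x)‖ ≤ 1 := by
  rw [Complex.norm_exp, Real.exp_le_one_iff]
  have : (-2 * k * x).re = -2 * (k.re * x) := by simp [mul_assoc]
  rw [this]
  have := mul_nonneg hk hx
  linarith

theorem norm_volterraKernel_le {k : ℂ} {δ : ℝ} (hδ : 0 < δ) (hk : 0 ≤ k.re) (hkδ : δ ≤ ‖k‖)
    (x : ℝ) : ‖volterraKernel k x‖ ≤ 1 / δ := by
  rw [volterraKernel, norm_div, norm_mul, Complex.norm_ofNat]
  have h1 := norm_exp_neg_mul_le_one hk (le_max_right x 0)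
  have h2 : ‖1 - Complex.exp (-2 * k * (max x 0 : ℝ))‖ ≤ 2 :=
    (norm_sub_le _ _).trans (by rw [norm_one]; linarith)
  calc _ ≤ 2 / (2 * ‖k‖) := by gcongr
    _ ≤ 2 / (2 * δ) := by gcongr
    _ = 1 / δ := by field_simp

theorem volterraKernel_of_nonpos (k : ℂ) {x : ℝ} (hx : x ≤ 0) : volterraKernel k x = 0 := by
  simp [volterraKernel, max_eq_right hx]

/-- Each iteration costs a kernel bound 1/δ and an integration of |V| times a power of its tail over
s > t, which raises the power by one and divides by n + 1. -/
theorem norm_jostTerm_le (hV : Integrable V volume) {k : ℂ} {δ : ℝ} (hδ : 0 < δ) (hk : 0 ≤ k.re)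
    (hkδ : δ ≤ ‖k‖) (n : ℕ) (t : ℝ) :
    ‖jostTerm V k n t‖ ≤ (tailNorm V t / δ) ^ n / (n.factorial : ℝ) := by
  induction n generalizing t with
  | zero => simp [jostTerm]
  | succ n ih =>
    rw [jostTerm]
    have hI := ((integrable_abs_mul_tailNorm_pow hV n).integrableOn (s := Set.Ioi t)).const_mul
      (1 / (δ ^ (n + 1) * n.factorial))
    refine (norm_integral_le_of_norm_le ((integrable_indicator_iff measurableSet_Ioi).2 hI)
      (Eventually.of_forall fun s => ?_)).trans_eq ?_
    · by_cases hs : t < s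
      · rw [Set.indicator_of_mem (Set.mem_Ioi.2 hs), norm_mul, norm_mul, Complex.norm_real,
          Real.norm_eq_abs]
        calc _ ≤ 1 / δ * (|V s| * ((tailNorm V s / δ) ^ n / (n.factorial : ℝ))) := by
              gcongr
              · exact norm_volterraKernel_le hδ hk hkδ _
              · exact ih s
          _ = _ := by rw [div_pow, pow_succ]; field_simp
      · rw [volterraKernel_of_nonpos k (by linarith), Set.indicator_of_notMem (by simpa using hs)]
        simp
    · rw [integral_indicator measurableSet_Ioi, integral_const_mul,
        setIntegral_abs_mul_tailNorm_pow hV, Nat.factorial_succ]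
      push_cast
      rw [div_pow]
      field_simp

theorem norm_jostTerm_le' (hV : Integrable V volume) {k : ℂ} {δ : ℝ} (hδ : 0 < δ) (hk : 0 ≤ k.re)
    (hkδ : δ ≤ ‖k‖) (n : ℕ) (t : ℝ) :
    ‖jostTerm V k n t‖ ≤ ((∫ s, |V s|) / δ) ^ n / (n.factorial : ℝ) := by
  refine (norm_jostTerm_le hV hδ hk hkδ n t).trans ?_
  have := tailNorm_nonneg V t
  have := tailNorm_le hV t
  gcongr

/-! ### Continuity in the spectral parameter and the Volterra equation -/

/-- The parameters with non-negative real part and modulus at least `δ`. -/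
def paramSet (δ : ℝ) : Set ℂ := {k | 0 ≤ k.re ∧ δ ≤ ‖k‖}

/-- Cutting off with max(x, 0) keeps the kernel continuous. The Volterra integrals thus run over the
fixed domain ℝ, where dominated convergence gives continuity in (k, t). -/
theorem continuousOn_volterraKernel {δ : ℝ} (hδ : 0 < δ) {X : Type*} [TopologicalSpace X]
    {κ : X → ℂ} {x : X → ℝ} {S : Set X} (hκ : ContinuousOn κ S) (hx : ContinuousOn x S)
    (hS : ∀ p ∈ S, κ p ∈ paramSet δ) :
    ContinuousOn (fun p => volterraKernel (κ p) (x p)) S := by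
  unfold volterraKernel
  refine ContinuousOn.div (by fun_prop) (by fun_prop) fun p hp => ?_
  have : κ p ≠ 0 := norm_pos_iff.1 (hδ.trans_le (hS p hp).2)
  simp [this]

theorem continuousOn_jostTerm (hV : Integrable V volume) {δ : ℝ} (hδ : 0 < δ) (n : ℕ) :
    ContinuousOn (fun p : ℂ × ℝ => jostTerm V p.1 n p.2) (paramSet δ ×ˢ Set.univ) := by
  induction n with
  | zero => exact continuousOn_const
  | succ n ih =>
    have hterm : ∀ k ∈ paramSet δ, Continuous (jostTerm V k n) := fun k hk => by
      rw [← continuousOn_univ]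
      exact ih.comp (by fun_prop : ContinuousOn (fun s : ℝ => (k, s)) Set.univ)
        fun s _ => ⟨hk, trivial⟩
    simp only [jostTerm]
    refine continuousOn_of_dominated (bound := fun s =>
      1 / δ * (|V s| * (((∫ s, |V s|) / δ) ^ n / (n.factorial : ℝ)))) ?_ ?_ ?_ ?_
    · rintro ⟨k, t⟩ ⟨hk, -⟩
      refine AEStronglyMeasurable.mul ?_ (hV.ofReal.1.mul (hterm k hk).aestronglyMeasurable)
      refine Continuous.aestronglyMeasurable ?_
      rw [← continuousOn_univ]
      exact continuousOn_volterraKernel hδ (by fun_prop) (by fun_prop) fun _ _ => hk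
    · rintro ⟨k, t⟩ ⟨hk, -⟩
      refine Eventually.of_forall fun s => ?_
      rw [norm_mul, norm_mul, Complex.norm_real, Real.norm_eq_abs]
      gcongr
      · exact norm_volterraKernel_le hδ hk.1 hk.2 _
      · exact norm_jostTerm_le' hV hδ hk.1 hk.2 n s
    · exact (hV.abs.mul_const _).const_mul _
    · refine Eventually.of_forall fun s => ?_
      refine (continuousOn_volterraKernel hδ (by fun_prop) (by fun_prop) fun p hp => hp.1).mul
        (continuousOn_const.mul ?_)
      exact ih.comp (by fun_prop : ContinuousOn (fun p : ℂ × ℝ => (p.1, s)) _)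
        fun p hp => ⟨hp.1, trivial⟩

theorem continuousOn_jostFactor (hV : Integrable V volume) {δ : ℝ} (hδ : 0 < δ) :
    ContinuousOn (fun p : ℂ × ℝ => jostFactor V p.1 p.2) (paramSet δ ×ˢ Set.univ) :=
  continuousOn_tsum (continuousOn_jostTerm hV hδ)
    (Real.summable_pow_div_factorial ((∫ s, |V s|) / δ))
    fun n p hp => norm_jostTerm_le' hV hδ hp.1.1 hp.1.2 n p.2

theorem mem_paramSet_norm {k : ℂ} (hk : 0 ≤ k.re) : k ∈ paramSet ‖k‖ := ⟨hk, le_rfl⟩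

theorem continuous_jostTerm (hV : Integrable V volume) {k : ℂ} (hk : 0 ≤ k.re) (hk0 : k ≠ 0)
    (n : ℕ) : Continuous (jostTerm V k n) := by
  rw [← continuousOn_univ]
  exact (continuousOn_jostTerm hV (norm_pos_iff.2 hk0) n).comp
    (by fun_prop : ContinuousOn (fun s : ℝ => (k, s)) Set.univ)
    fun s _ => ⟨mem_paramSet_norm hk, trivial⟩

theorem continuous_jostFactor (hV : Integrable V volume) {k : ℂ} (hk : 0 ≤ k.re) (hk0 : k ≠ 0) :
    Continuous (jostFactor V k) := by
  rw [← continuousOn_univ]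
  exact (continuousOn_jostFactor hV (norm_pos_iff.2 hk0)).comp
    (by fun_prop : ContinuousOn (fun s : ℝ => (k, s)) Set.univ)
    fun s _ => ⟨mem_paramSet_norm hk, trivial⟩

theorem norm_jostFactor_le (hV : Integrable V volume) {δ : ℝ} (hδ : 0 < δ) {k : ℂ}
    (hk : k ∈ paramSet δ) (t : ℝ) : ‖jostFactor V k t‖ ≤ jostBound V δ :=
  tsum_of_norm_bounded (Real.summable_pow_div_factorial ((∫ s, |V s|) / δ)).hasSum
    fun n => norm_jostTerm_le' hV hδ hk.1 hk.2 n t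

theorem integrable_mul_jostFactor (hV : Integrable V volume) {k : ℂ} (hk : 0 ≤ k.re)
    (hk0 : k ≠ 0) : Integrable (fun s => (V s : ℂ) * jostFactor V k s) volume :=
  hV.ofReal.mul_bdd (continuous_jostFactor hV hk hk0).aestronglyMeasurable
    (Eventually.of_forall fun s => norm_jostFactor_le hV (norm_pos_iff.2 hk0)
      (mem_paramSet_norm hk) s)

/-- The Volterra equation. -/
theorem jostFactor_eq (hV : Integrable V volume) {k : ℂ} (hk : 0 ≤ k.re) (hk0 : k ≠ 0) (t : ℝ) :
    jostFactor V k t = 1 + ∫ s, volterraKernel k (s - t) * (V s * jostFactor V k s) := by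
  have hδ := norm_pos_iff.2 hk0
  have hsum : ∀ s, Summable fun n => jostTerm V k n s := fun s =>
    Summable.of_norm_bounded (Real.summable_pow_div_factorial ((∫ s, |V s|) / ‖k‖))
      fun n => norm_jostTerm_le' hV hδ hk le_rfl n s
  have hbd : ∀ (n : ℕ) (s : ℝ), ‖volterraKernel k (s - t) * (V s * jostTerm V k n s)‖ ≤
      1 / ‖k‖ * (|V s| * (((∫ s, |V s|) / ‖k‖) ^ n / (n.factorial : ℝ))) := fun n s => by
    rw [norm_mul, norm_mul, Complex.norm_real, Real.norm_eq_abs]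
    gcongr
    · exact norm_volterraKernel_le hδ hk le_rfl _
    · exact norm_jostTerm_le' hV hδ hk le_rfl n s
  have hker : Continuous fun s : ℝ => volterraKernel k (s - t) := by
    rw [← continuousOn_univ]
    exact continuousOn_volterraKernel hδ (by fun_prop) (by fun_prop)
      fun _ _ => mem_paramSet_norm hk
  have hint : ∀ n, Integrable (fun s => volterraKernel k (s - t) * (V s * jostTerm V k n s))
      volume := fun n =>
    ((hV.abs.mul_const _).const_mul _).mono' (hker.aestronglyMeasurable.mul
      (hV.ofReal.1.mul (continuous_jostTerm hV hk hk0 n).aestronglyMeasurable))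
      (Eventually.of_forall (hbd n))
  -- The L¹ norms of the summands are dominated by an exponential series, so sum and integral may be
  -- exchanged.
  have h := hasSum_integral_of_summable_integral_norm hint (by
    refine Summable.of_nonneg_of_le (fun n => integral_nonneg fun _ => norm_nonneg _)
      (fun n => integral_mono (hint n).norm ((hV.abs.mul_const _).const_mul _) (hbd n)) ?_
    simp only [integral_const_mul, integral_mul_const]
    exact ((Real.summable_pow_div_factorial _).mul_left _).mul_left _)
  rw [jostFactor, (hsum t).tsum_eq_zero_add]
  simp only [jostTerm]
  rw [h.tsum_eq]
  congr 2
  funext s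
  rw [tsum_mul_left, tsum_mul_left, jostFactor]

/-! ### From the Volterra equation to the Schrödinger equation -/

/-- The coefficient `1 + ∫_t^∞ V f / (2 k)` of `exp(-k t)` in the variation of constants formula. -/
def jostCoeff (V : ℝ → ℝ) (k : ℂ) (t : ℝ) : ℂ :=
  1 + (∫ s in Set.Ioi t, V s * jostFactor V k s) / (2 * k)

/-- The solution of `(H + k²) ψ = 0` with `ψ(t) ∼ exp(-k t)` at `+∞`. -/
def jostSol (V : ℝ → ℝ) (k : ℂ) (t : ℝ) : ℂ := Complex.exp (-k * t) * jostFactor V k t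

/-- The function `exp(k t) ψ₊'(k, t)`. -/
def jostDerivFactor (V : ℝ → ℝ) (k : ℂ) (t : ℝ) : ℂ :=
  k * (jostFactor V k t - 2 * jostCoeff V k t)

/-- Splitting the two terms of the kernel separates the t-dependence into coefficients of exp(-kt)
and exp(kt), the form needed for variation of constants. Each half converges because Re k ≥ 0 bounds
the exponential on s > t. -/
theorem jostFactor_eq_add (hV : Integrable V volume) {k : ℂ} (hk : 0 ≤ k.re) (hk0 : k ≠ 0)
    (t : ℝ) : jostFactor V k t = jostCoeff V k t - Complex.exp (2 * k * t) *
      ((∫ s in Set.Ioi t, Complex.exp (-2 * k * s) * (V s * jostFactor V k s)) / (2 * k)) := by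
  have hi := integrable_mul_jostFactor hV hk hk0
  have hi2 : IntegrableOn (fun s : ℝ => Complex.exp (-2 * k * (s - t)) *
      (V s * jostFactor V k s)) (Set.Ioi t) volume := by
    refine hi.integrableOn.bdd_mul (c := 1) (by fun_prop) ?_
    filter_upwards [ae_restrict_mem measurableSet_Ioi] with s hs
    have := norm_exp_neg_mul_le_one hk (sub_nonneg.2 (Set.mem_Ioi.1 hs).le)
    simpa using this
  rw [jostFactor_eq hV hk hk0 t, jostCoeff]
  have h1 : ∫ s, volterraKernel k (s - t) * (V s * jostFactor V k s) =
      ∫ s in Set.Ioi t, volterraKernel k (s - t) * (V s * jostFactor V k s) := by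
    symm
    refine setIntegral_eq_integral_of_forall_compl_eq_zero fun s hs => ?_
    have hs' : s ≤ t := by simpa using hs
    rw [volterraKernel_of_nonpos k (sub_nonpos.2 hs'), zero_mul]
  have h2 : ∫ s in Set.Ioi t, volterraKernel k (s - t) * (V s * jostFactor V k s) =
      ∫ s in Set.Ioi t, (V s * jostFactor V k s - Complex.exp (-2 * k * (s - t)) *
        (V s * jostFactor V k s)) / (2 * k) := by
    refine setIntegral_congr_fun measurableSet_Ioi fun s hs => ?_
    have hm : max (s - t) 0 = s - t := max_eq_left (sub_nonneg.2 (Set.mem_Ioi.1 hs).le)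
    simp only [volterraKernel, hm]
    push_cast; ring
  have h3 : Complex.exp (2 * k * t) *
      ∫ s in Set.Ioi t, Complex.exp (-2 * k * s) * (V s * jostFactor V k s) =
      ∫ s in Set.Ioi t, Complex.exp (-2 * k * (s - t)) * (V s * jostFactor V k s) := by
    rw [← integral_const_mul]
    refine setIntegral_congr_fun measurableSet_Ioi fun s _ => ?_
    rw [← mul_assoc, ← Complex.exp_add]
    congr 2; ring
  rw [h1, h2, integral_div, integral_sub hi.integrableOn hi2, ← mul_div_assoc, h3]
  ring

/-- Write ψ = α exp(kt) + β exp(-kt). The coefficients satisfy α' exp(kt) + β' exp(-kt) = 0, so ψ' =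
k(α exp(kt) - β exp(-kt)), and one more differentiation yields k²ψ + Vψ. -/
theorem isPrimitive_jostSol (hV : Integrable V volume) {k : ℂ} (hk : 0 ≤ k.re) (hk0 : k ≠ 0) :
    IsPrimitive (jostSol V k) (fun t => Complex.exp (-k * t) * jostDerivFactor V k t) ∧
    IsPrimitive (fun t => Complex.exp (-k * t) * jostDerivFactor V k t)
      (fun t => ((V t : ℂ) - -k ^ 2) * jostSol V k t) := by
  have hi := integrable_mul_jostFactor hV hk hk0
  have hβ : IsPrimitive (jostCoeff V k)
      (fun t => -((V t : ℂ) * jostFactor V k t / (2 * k))) :=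
    ((IsPrimitive.const 1).add ((IsPrimitive.setIntegral_Ioi hi.locallyIntegrable
      fun t => hi.integrableOn).const_mul (1 / (2 * k)))).congr
      (fun t => by rw [jostCoeff]; ring) (fun t => by ring)
  have hloc : LocallyIntegrable (fun s : ℝ => Complex.exp (-2 * k * s) *
      (V s * jostFactor V k s)) volume :=
    LocallyIntegrable.continuous_mul hi.locallyIntegrable (by fun_prop)
  have hion : ∀ t, IntegrableOn (fun s : ℝ => Complex.exp (-2 * k * s) *
      (V s * jostFactor V k s)) (Set.Ioi t) volume := fun t => by
    refine hi.integrableOn.bdd_mul (c := Real.exp (-2 * k.re * t)) (by fun_prop) ?_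
    filter_upwards [ae_restrict_mem measurableSet_Ioi] with s hs
    rw [Complex.norm_exp]
    have : (-2 * k * s).re = -2 * k.re * s := by simp [mul_assoc]
    rw [this]
    rw [Real.exp_le_exp]
    have := mul_le_mul_of_nonneg_left (Set.mem_Ioi.1 hs).le hk
    linarith
  obtain ⟨α, hαdef⟩ : ∃ α : ℝ → ℂ, ∀ t, α t = -(1 / (2 * k)) *
    ∫ s in Set.Ioi t, Complex.exp (-2 * k * s) * (V s * jostFactor V k s) := ⟨_, fun _ => rfl⟩
  have hα : IsPrimitive α
      (fun t => Complex.exp (-2 * k * t) * (V t * jostFactor V k t) / (2 * k)) :=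
    ((IsPrimitive.setIntegral_Ioi hloc hion).const_mul (-(1 / (2 * k)))).congr
      (fun t => (hαdef t).symm) (fun t => by ring)
  have hf : ∀ t, jostFactor V k t = jostCoeff V k t + Complex.exp (2 * k * t) * α t := fun t => by
    rw [jostFactor_eq_add hV hk hk0 t, hαdef]; ring
  have he : ∀ t : ℝ, Complex.exp (k * t) = Complex.exp (-k * t) * Complex.exp (2 * k * t) :=
    fun t => by rw [← Complex.exp_add]; congr 1; ring
  have he2 : ∀ t : ℝ, Complex.exp (-2 * k * t) * Complex.exp (2 * k * t) = 1 :=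
    fun t => by rw [← Complex.exp_add, ← Complex.exp_zero]; congr 1; ring
  have p1 := hα.mul (isPrimitive_exp k)
  have p2 := hβ.mul (isPrimitive_exp (-k))
  constructor
  · refine (p1.add p2).congr (fun t => ?_) (fun t => ?_)
    · rw [jostSol, hf, he]; ring
    · rw [jostDerivFactor, hf t, he t]
      -- The exponentials become atoms whose only remaining relation is `h2`.
      have h2 := he2 t
      generalize Complex.exp (-2 * k * t) = x at *
      generalize Complex.exp (2 * k * t) = y at *
      generalize Complex.exp (-k * t) = w at *
      field_simp
      linear_combination w * V t * (jostCoeff V k t + y * α t) * h2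
  · refine ((p1.sub p2).const_mul k).congr (fun t => ?_) (fun t => ?_)
    · rw [jostDerivFactor, hf, he]; ring
    · rw [jostSol, hf t, he t]
      have h2 := he2 t
      generalize Complex.exp (-2 * k * t) = x at *
      generalize Complex.exp (2 * k * t) = y at *
      generalize Complex.exp (-k * t) = w at *
      field_simp
      linear_combination w * V t * (jostCoeff V k t + y * α t) * h2

theorem isSolution_jostSol (hV : Integrable V volume) {k : ℂ} (hk : 0 ≤ k.re) (hk0 : k ≠ 0) :
    IsSolution V (-k ^ 2) (jostSol V k) :=
  (IsSolution.of_isPrimitive (isPrimitive_jostSol hV hk hk0).1 (isPrimitive_jostSol hV hk hk0).2).1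

theorem deriv_jostSol (hV : Integrable V volume) {k : ℂ} (hk : 0 ≤ k.re) (hk0 : k ≠ 0) (t : ℝ) :
    deriv (jostSol V k) t = Complex.exp (-k * t) * jostDerivFactor V k t :=
  congrFun (IsSolution.of_isPrimitive (isPrimitive_jostSol hV hk hk0).1
    (isPrimitive_jostSol hV hk hk0).2).2 t

/-- The Volterra equation bounds the distance to 1 by 1/‖k‖ times a tail of an integrable function.
-/
theorem tendsto_jostFactor (hV : Integrable V volume) {k : ℂ} (hk : 0 ≤ k.re) (hk0 : k ≠ 0) :
    Tendsto (jostFactor V k) atTop (𝓝 1) := by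
  have hi := integrable_mul_jostFactor hV hk hk0
  have hδ := norm_pos_iff.2 hk0
  have h0 := (tendsto_setIntegral_Ioi_atTop hi.norm).const_mul (1 / ‖k‖)
  rw [mul_zero] at h0
  rw [tendsto_iff_norm_sub_tendsto_zero]
  refine squeeze_zero (fun _ => norm_nonneg _) (fun t => ?_) h0
  rw [jostFactor_eq hV hk hk0 t, add_sub_cancel_left, ← integral_const_mul,
    ← integral_indicator measurableSet_Ioi]
  refine norm_integral_le_of_norm_le ((integrable_indicator_iff measurableSet_Ioi).2
    (hi.norm.const_mul _).integrableOn) (Eventually.of_forall fun s => ?_)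
  by_cases hs : t < s
  · rw [Set.indicator_of_mem (Set.mem_Ioi.2 hs), norm_mul]
    gcongr
    exact norm_volterraKernel_le hδ hk le_rfl _
  · rw [volterraKernel_of_nonpos k (by linarith), Set.indicator_of_notMem (by simpa using hs)]
    simp

theorem tendsto_jostDerivFactor (hV : Integrable V volume) {k : ℂ} (hk : 0 ≤ k.re)
    (hk0 : k ≠ 0) : Tendsto (jostDerivFactor V k) atTop (𝓝 (-k)) := by
  have hi := integrable_mul_jostFactor hV hk hk0
  have hβ : Tendsto (jostCoeff V k) atTop (𝓝 1) := by
    have := ((tendsto_setIntegral_Ioi_atTop hi).div_const (2 * k)).const_add 1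
    simpa [funext (jostCoeff.eq_1 V k)] using this
  have := ((tendsto_jostFactor hV hk hk0).sub (hβ.const_mul 2)).const_mul k
  convert! this using 2
  ring

theorem exists_norm_jostDerivFactor_le (hV : Integrable V volume) {k : ℂ} (hk : 0 ≤ k.re)
    (hk0 : k ≠ 0) : ∃ C, ∀ t, ‖jostDerivFactor V k t‖ ≤ C := by
  have hi := integrable_mul_jostFactor hV hk hk0
  refine ⟨‖k‖ * (jostBound V ‖k‖ + 2 * (1 +
    (∫ s, ‖(V s : ℂ) * jostFactor V k s‖) / ‖2 * k‖)), fun t => ?_⟩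
  rw [jostDerivFactor, norm_mul]
  gcongr
  refine (norm_sub_le _ _).trans (add_le_add
    (norm_jostFactor_le hV (norm_pos_iff.2 hk0) (mem_paramSet_norm hk) t) ?_)
  rw [norm_mul, Complex.norm_ofNat, jostCoeff]
  gcongr
  refine (norm_add_le _ _).trans (add_le_add norm_one.le ?_)
  rw [norm_div]
  gcongr
  exact (norm_integral_le_integral_norm _).trans
    (setIntegral_le_integral hi.norm (Eventually.of_forall fun _ => norm_nonneg _))

theorem continuousOn_jostFactor_param (hV : Integrable V volume) {δ : ℝ} (hδ : 0 < δ) (t : ℝ) :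
    ContinuousOn (fun k => jostFactor V k t) (paramSet δ) :=
  (continuousOn_jostFactor hV hδ).comp (by fun_prop : ContinuousOn (fun k : ℂ => (k, t)) _)
    fun _ hk => ⟨hk, trivial⟩

theorem continuousOn_jostDerivFactor_param (hV : Integrable V volume) {δ : ℝ} (hδ : 0 < δ)
    (t : ℝ) : ContinuousOn (fun k => jostDerivFactor V k t) (paramSet δ) := by
  have hne : ∀ k ∈ paramSet δ, k ≠ 0 := fun k hk => norm_pos_iff.1 (hδ.trans_le hk.2)
  have hint : ContinuousOn (fun k => ∫ s in Set.Ioi t, V s * jostFactor V k s) (paramSet δ) := by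
    refine continuousOn_of_dominated (bound := fun s => |V s| * jostBound V δ) ?_ ?_ ?_ ?_
    · intro k hk
      exact (integrable_mul_jostFactor hV hk.1 (hne k hk)).1.restrict
    · intro k hk
      refine Eventually.of_forall fun s => ?_
      rw [norm_mul, Complex.norm_real, Real.norm_eq_abs]
      gcongr
      exact norm_jostFactor_le hV hδ hk s
    · exact (hV.abs.mul_const _).integrableOn
    · exact Eventually.of_forall fun s =>
        continuousOn_const.mul (continuousOn_jostFactor_param hV hδ s)
  unfold jostDerivFactor jostCoeff
  exact continuousOn_id.mul ((continuousOn_jostFactor_param hV hδ t).sub (continuousOn_const.mul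
    (continuousOn_const.add (hint.div (by fun_prop) fun k hk => by simp [hne k hk]))))

/-! ### Jost solutions: Wronskians and uniqueness -/

theorem IsPrimitive.conj {F f : ℝ → ℂ} (h : IsPrimitive F f) :
    IsPrimitive (fun t => (starRingEnd ℂ) (F t)) (fun t => (starRingEnd ℂ) (f t)) := by
  refine ⟨?_, fun a b => ?_⟩
  · have := h.locallyIntegrable
    rw [locallyIntegrable_iff] at this ⊢
    exact fun K hK => Complex.conjCLE.toContinuousLinearMap.integrable_comp (this K hK)
  · have := Complex.conjCLE.toContinuousLinearMap.intervalIntegral_comp_comm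
      (h.intervalIntegrable a b)
    rw [← h.sub_eq, map_sub] at this
    exact this.symm

/-- The Jost solution at `-∞`, obtained by reflection. -/
def jostSolMinus (V : ℝ → ℝ) (k : ℂ) (t : ℝ) : ℂ := jostSol (fun t => V (-t)) k (-t)

theorem isSolution_jostSolMinus (hV : Integrable V volume) {k : ℂ} (hk : 0 ≤ k.re)
    (hk0 : k ≠ 0) : IsSolution V (-k ^ 2) (jostSolMinus V k) := by
  have h := (isSolution_jostSol hV.comp_neg hk hk0).comp_neg
  simp only [neg_neg] at h
  exact h

theorem deriv_jostSolMinus (V : ℝ → ℝ) (k : ℂ) (t : ℝ) :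
    deriv (jostSolMinus V k) t = -deriv (jostSol (fun t => V (-t)) k) (-t) :=
  deriv_comp_neg _ _

/-- Flux identity: in the derivative of ψ' ψ̄ - ψ ψ̄' the real potential cancels, leaving (z̄ -
z)|ψ|². -/
theorem IsSolution.im_deriv_mul_conj_sub (hV : LocallyIntegrable V volume) {z : ℂ} {ψ : ℝ → ℂ}
    (h : IsSolution V z ψ) (a b : ℝ) :
    (deriv ψ b * (starRingEnd ℂ) (ψ b)).im - (deriv ψ a * (starRingEnd ℂ) (ψ a)).im =
      -z.im * ∫ t in a..b, ‖ψ t‖ ^ 2 := by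
  obtain ⟨p1, p2⟩ := h.isPrimitive hV
  have hp := (p2.mul p1.conj).sub (p1.mul p2.conj)
  have hs := hp.sub_eq a b
  have hint : ∀ t : ℝ, ((V t : ℂ) - z) * ψ t * (starRingEnd ℂ) (ψ t) +
      deriv ψ t * (starRingEnd ℂ) (deriv ψ t) - (deriv ψ t * (starRingEnd ℂ) (deriv ψ t) +
        ψ t * (starRingEnd ℂ) (((V t : ℂ) - z) * ψ t)) =
      ((starRingEnd ℂ) z - z) * ((‖ψ t‖ ^ 2 : ℝ) : ℂ) := fun t => by
    rw [← Complex.normSq_eq_norm_sq, ← Complex.mul_conj]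
    simp only [map_mul, map_sub, Complex.conj_ofReal]
    ring
  have hre : ∫ t in a..b, ((‖ψ t‖ ^ 2 : ℝ) : ℂ) = ((∫ t in a..b, ‖ψ t‖ ^ 2 : ℝ) : ℂ) :=
    intervalIntegral.integral_ofReal
  simp only [hint, intervalIntegral.integral_const_mul] at hs
  rw [hre] at hs
  have := congrArg Complex.im hs
  simp at this ⊢
  linarith

/-- By the flux identity with z = -k², the quantity Im k · Im(ψ' ψ̄) is nondecreasing in t when Re k
≥ 0. Divided by |exp(-kt)|² it tends to -(Im k)² at +∞, so it is negative for large times and hence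
for all earlier ones. No decay is needed, so the case Re k = 0 is included. -/
theorem im_mul_im_deriv_jostSol_neg (hV : Integrable V volume) {k : ℂ} (hk : 0 ≤ k.re)
    (hk1 : k.im ≠ 0) (t : ℝ) :
    k.im * (deriv (jostSol V k) t * (starRingEnd ℂ) (jostSol V k t)).im < 0 := by
  have hk0 : k ≠ 0 := fun h => hk1 (by simp [h])
  have hlim : Tendsto (fun T => k.im * (jostDerivFactor V k T *
      (starRingEnd ℂ) (jostFactor V k T)).im) atTop (𝓝 (k.im * (-k * (starRingEnd ℂ) 1).im)) :=
    ((Complex.continuous_im.tendsto _).comp ((tendsto_jostDerivFactor hV hk hk0).mul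
      ((Complex.continuous_conj.tendsto _).comp (tendsto_jostFactor hV hk hk0)))).const_mul _
  have hneg : k.im * (-k * (starRingEnd ℂ) 1).im < 0 := by
    have := mul_self_pos.2 hk1
    rw [map_one, mul_one, Complex.neg_im]
    linarith
  obtain ⟨T, hT, htT⟩ := ((hlim.eventually (gt_mem_nhds hneg)).and (eventually_ge_atTop t)).exists
  have hd := (isSolution_jostSol hV hk hk0).im_deriv_mul_conj_sub hV.locallyIntegrable t T
  have hI : 0 ≤ ∫ t in t..T, ‖jostSol V k t‖ ^ 2 :=
    intervalIntegral.integral_nonneg htT fun _ _ => by positivity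
  have hz : (-k ^ 2).im = -(2 * k.re * k.im) := by simp [pow_two]; ring
  have hTneg : k.im * (deriv (jostSol V k) T * (starRingEnd ℂ) (jostSol V k T)).im < 0 := by
    rw [deriv_jostSol hV hk hk0, jostSol]
    have he : Complex.exp (-k * T) * jostDerivFactor V k T *
        (starRingEnd ℂ) (Complex.exp (-k * T) * jostFactor V k T) =
        ((Complex.normSq (Complex.exp (-k * T)) : ℝ) : ℂ) *
          (jostDerivFactor V k T * (starRingEnd ℂ) (jostFactor V k T)) := by
      rw [← Complex.mul_conj, map_mul]; ring
    rw [he, Complex.im_ofReal_mul]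
    have := Complex.normSq_pos.2 (Complex.exp_ne_zero (-k * T))
    nlinarith
  rw [hz] at hd
  have h3 : k.im * (deriv (jostSol V k) T * (starRingEnd ℂ) (jostSol V k T)).im -
      k.im * (deriv (jostSol V k) t * (starRingEnd ℂ) (jostSol V k t)).im =
      2 * (k.re * ((k.im * k.im) * ∫ t in t..T, ‖jostSol V k t‖ ^ 2)) := by
    rw [← mul_sub, hd]; ring
  have h4 := mul_nonneg hk (mul_nonneg (mul_self_nonneg k.im) hI)
  linarith

theorem jostSol_ne_zero (hV : Integrable V volume) {k : ℂ} (hk : 0 ≤ k.re)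
    (hk1 : k.im ≠ 0) (t : ℝ) : jostSol V k t ≠ 0 := fun h => by
  simpa [h] using im_mul_im_deriv_jostSol_neg hV hk hk1 t

/-- A zero Wronskian would equate the logarithmic derivatives of the two solutions at 0. Their
imaginary parts have opposite signs, because reflection reverses the flux. -/
theorem wronskian_jostSol_jostSolMinus_ne_zero (hV : Integrable V volume) {k : ℂ}
    (hk : 0 ≤ k.re) (hk1 : k.im ≠ 0) : wronskian (jostSol V k) (jostSolMinus V k) 0 ≠ 0 := by
  intro h
  have h1 := im_mul_im_deriv_jostSol_neg hV hk hk1 0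
  have h2 := im_mul_im_deriv_jostSol_neg hV.comp_neg hk hk1 0
  have hp := Complex.normSq_pos.2 (jostSol_ne_zero hV hk hk1 0)
  have hq := Complex.normSq_pos.2 (jostSol_ne_zero hV.comp_neg hk hk1 0)
  rw [wronskian, deriv_jostSolMinus, jostSolMinus, neg_zero] at h
  generalize jostSol V k 0 = p at *
  generalize deriv (jostSol V k) 0 = p' at *
  generalize jostSol (fun t => V (-t)) k 0 = q at *
  generalize deriv (jostSol (fun t => V (-t)) k) 0 = q' at *
  -- The vanishing Wronskian multiplied by p̄ q̄, which turns it into a relation between the two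
  -- fluxes.
  have h3 : ((Complex.normSq p : ℝ) : ℂ) * (q' * (starRingEnd ℂ) q) =
      -(((Complex.normSq q : ℝ) : ℂ) * (p' * (starRingEnd ℂ) p)) := by
    rw [← Complex.mul_conj, ← Complex.mul_conj]
    linear_combination -(starRingEnd ℂ) p * (starRingEnd ℂ) q * h
  have h4 := congrArg Complex.im h3
  rw [Complex.im_ofReal_mul, Complex.neg_im, Complex.im_ofReal_mul] at h4
  have h5 : Complex.normSq p * (k.im * (q' * (starRingEnd ℂ) q).im) =
      -(Complex.normSq q * (k.im * (p' * (starRingEnd ℂ) p).im)) := by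
    linear_combination k.im * h4
  have h6 := mul_neg_of_pos_of_neg hp h2
  have h7 := mul_neg_of_pos_of_neg hq h1
  linarith

/-- The Wronskian is constant and can be read off at +∞, where the exponentials cancel. Re k = 0
makes both k and -k admissible parameters. -/
theorem wronskian_jostSol_jostSol_neg (hV : Integrable V volume) {k : ℂ} (hk : k.re = 0)
    (hk0 : k ≠ 0) (t : ℝ) : wronskian (jostSol V k) (jostSol V (-k)) t = 2 * k := by
  have hk' : 0 ≤ (-k).re := by simp [hk]
  have hn0 : -k ≠ 0 := neg_ne_zero.2 hk0
  have hs := isSolution_jostSol hV hk.ge hk0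
  have hs' := isSolution_jostSol hV hk' hn0
  rw [neg_sq] at hs'
  have hlim := ((tendsto_jostFactor hV hk.ge hk0).mul (tendsto_jostDerivFactor hV hk' hn0)).sub
    ((tendsto_jostDerivFactor hV hk.ge hk0).mul (tendsto_jostFactor hV hk' hn0))
  have he : ∀ T, jostFactor V k T * jostDerivFactor V (-k) T -
      jostDerivFactor V k T * jostFactor V (-k) T =
      wronskian (jostSol V k) (jostSol V (-k)) t := fun T => by
    rw [hs.wronskian_eq hV.locallyIntegrable hs' t T, wronskian, deriv_jostSol hV hk.ge hk0,
      deriv_jostSol hV hk' hn0, jostSol, jostSol]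
    have : Complex.exp (-k * T) * Complex.exp (- -k * T) = 1 := by
      rw [← Complex.exp_add, ← Complex.exp_zero]; congr 1; ring
    linear_combination -(jostFactor V k T * jostDerivFactor V (-k) T -
      jostDerivFactor V k T * jostFactor V (-k) T) * this
  have := tendsto_nhds_unique (tendsto_const_nhds.congr fun T => (he T).symm) hlim
  rw [this]; ring

theorem isJostPlus_jostSol (hV : Integrable V volume) {k : ℂ} (hk : 0 ≤ k.re) (hk0 : k ≠ 0) :
    IsJostPlus V k (jostSol V k) := by
  refine ⟨isSolution_jostSol hV hk hk0, ?_⟩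
  refine isEquivalent_of_tendsto_one ((tendsto_jostFactor hV hk hk0).congr fun t => ?_)
  simp [jostSol, Complex.exp_ne_zero]

/-- A shift by π/(2 Im k) reverses the sign, so L = -L. The modulus is constantly ‖b‖, which must
then be 0. -/
theorem eq_zero_of_tendsto_mul_exp {k b L : ℂ} (hk : k.re = 0) (hk0 : k ≠ 0)
    (h : Tendsto (fun t : ℝ => b * Complex.exp (2 * k * t)) atTop (𝓝 L)) : b = 0 ∧ L = 0 := by
  have him : k.im ≠ 0 := fun h => hk0 (Complex.ext hk h)
  have hkI : k = k.im * Complex.I := Complex.ext (by simp [hk]) (by simp)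
  have hL : L = 0 := by
    have h2 := h.comp (tendsto_atTop_add_const_right atTop (Real.pi / (2 * k.im)) tendsto_id)
    have h3 : Tendsto (fun t : ℝ => b * Complex.exp (2 * k * t)) atTop (𝓝 (-L)) := by
      refine h2.neg.congr fun t => ?_
      have : 2 * k * ((t + Real.pi / (2 * k.im) : ℝ) : ℂ) = 2 * k * t + Real.pi * Complex.I := by
        have : (k.im : ℂ) ≠ 0 := by exact_mod_cast him
        push_cast
        rw [hkI]
        simp only [Complex.mul_im, Complex.ofReal_re, Complex.I_im, Complex.ofReal_im,
          Complex.I_re, mul_one, mul_zero, add_zero]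
        field_simp
      simp only [Function.comp, id, this, Complex.exp_add, Complex.exp_pi_mul_I]
      ring
    exact self_eq_neg.1 (tendsto_nhds_unique h h3)
  refine ⟨?_, hL⟩
  have hn := h.norm
  have : ∀ t : ℝ, ‖b * Complex.exp (2 * k * t)‖ = ‖b‖ := fun t => by
    rw [norm_mul, Complex.norm_exp]
    simp [hk]
  simp only [this, hL, norm_zero] at hn
  exact norm_eq_zero.1 (tendsto_nhds_unique tendsto_const_nhds hn)

/-- In the basis of Jost solutions at k and -k, the prescribed asymptotics force the oscillating
term b exp(2kt) to converge to 1 - a. Hence b = 0 and a = 1. -/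
theorem IsJostPlus.eq_jostSol (hV : Integrable V volume) {k : ℂ} (hk : k.re = 0) (hk0 : k ≠ 0)
    {ψ : ℝ → ℂ} (h : IsJostPlus V k ψ) : ψ = jostSol V k := by
  have hk' : 0 ≤ (-k).re := by simp [hk]
  have hn0 : -k ≠ 0 := neg_ne_zero.2 hk0
  have hs := isSolution_jostSol hV hk.ge hk0
  have hs' := isSolution_jostSol hV hk' hn0
  rw [neg_sq] at hs'
  have hc := h.1.eq_combination hV.locallyIntegrable hs hs'
    (by rw [wronskian_jostSol_jostSol_neg hV hk hk0]; simpa using hk0)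
  generalize wronskian ψ (jostSol V (-k)) 0 / wronskian (jostSol V k) (jostSol V (-k)) 0 = a at hc
  generalize wronskian (jostSol V k) ψ 0 / wronskian (jostSol V k) (jostSol V (-k)) 0 = b at hc
  have h1 := (isEquivalent_iff_tendsto_one
    (Eventually.of_forall fun t : ℝ => Complex.exp_ne_zero (-k * t))).1 h.2
  have hf := tendsto_jostFactor hV hk.ge hk0
  have hf' := tendsto_jostFactor hV hk' hn0
  have h2 : Tendsto (fun t : ℝ => b * Complex.exp (2 * k * t)) atTop (𝓝 ((1 - a * 1) / 1)) := by
    refine ((h1.sub (hf.const_mul a)).div hf' one_ne_zero).congr' ?_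
    filter_upwards [hf'.eventually_ne one_ne_zero] with t ht
    rw [Pi.div_apply, Pi.div_apply, hc t, jostSol, jostSol]
    have he : Complex.exp (- -k * t) = Complex.exp (-k * t) * Complex.exp (2 * k * t) := by
      rw [← Complex.exp_add]; congr 1; ring
    have := Complex.exp_ne_zero (-k * t)
    rw [he, div_eq_iff ht]
    field_simp
    ring
  obtain ⟨hb, ha⟩ := eq_zero_of_tendsto_mul_exp hk hk0 h2
  have ha' : a = 1 := by
    rw [div_one, mul_one] at ha
    exact (sub_eq_zero.1 ha).symm
  funext t
  rw [hc t, hb, ha']; ring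

theorem IsJostMinus.comp_neg {k : ℂ} {ψ : ℝ → ℂ} (h : IsJostMinus V k ψ) :
    IsJostPlus (fun t => V (-t)) k (fun t => ψ (-t)) := by
  refine ⟨h.1.comp_neg, ?_⟩
  have := h.2.comp_tendsto tendsto_neg_atTop_atBot
  simpa [Function.comp_def] using this

theorem isJostMinus_jostSolMinus (hV : Integrable V volume) {k : ℂ} (hk : 0 ≤ k.re)
    (hk0 : k ≠ 0) : IsJostMinus V k (jostSolMinus V k) := by
  refine ⟨isSolution_jostSolMinus hV hk hk0, ?_⟩
  have := (isJostPlus_jostSol hV.comp_neg hk hk0).2.comp_tendsto tendsto_neg_atBot_atTop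
  simpa [Function.comp_def, jostSolMinus, funext (jostSolMinus.eq_1 V k)] using this

theorem IsJostMinus.eq_jostSolMinus (hV : Integrable V volume) {k : ℂ} (hk : k.re = 0)
    (hk0 : k ≠ 0) {ψ : ℝ → ℂ} (h : IsJostMinus V k ψ) : ψ = jostSolMinus V k := by
  have := h.comp_neg.eq_jostSol hV.comp_neg hk hk0
  funext t
  have ht := congrFun this (-t)
  simpa [jostSolMinus] using ht

theorem existsUnique_isJostPlus (hV : Integrable V volume) {k : ℂ} (hk : k.re = 0)
    (hk0 : k ≠ 0) : ∃! ψ, IsJostPlus V k ψ :=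
  ⟨_, isJostPlus_jostSol hV hk.ge hk0, fun _ h => h.eq_jostSol hV hk hk0⟩

theorem existsUnique_isJostMinus (hV : Integrable V volume) {k : ℂ} (hk : k.re = 0)
    (hk0 : k ≠ 0) : ∃! ψ, IsJostMinus V k ψ :=
  ⟨_, isJostMinus_jostSolMinus hV hk.ge hk0, fun _ h => h.eq_jostSolMinus hV hk hk0⟩

theorem jostPlus_eq (hV : Integrable V volume) {k : ℂ} (hk : k.re = 0) (hk0 : k ≠ 0) :
    jostPlus V k = jostSol V k :=
  IsJostPlus.eq_jostSol hV hk hk0 (Classical.epsilon_spec ⟨_, isJostPlus_jostSol hV hk.ge hk0⟩)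

theorem jostMinus_eq (hV : Integrable V volume) {k : ℂ} (hk : k.re = 0) (hk0 : k ≠ 0) :
    jostMinus V k = jostSolMinus V k :=
  IsJostMinus.eq_jostSolMinus hV hk hk0
    (Classical.epsilon_spec ⟨_, isJostMinus_jostSolMinus hV hk.ge hk0⟩)

/-! ### Scattering coefficients and the canonical bisolution -/

theorem coeff_eq_of_combination_eq {ψ φ : ℝ → ℂ} (hψ : Differentiable ℝ ψ)
    (hφ : Differentiable ℝ φ) {t₀ : ℝ} (hW : wronskian ψ φ t₀ ≠ 0) {a b c d : ℂ}
    (h : ∀ t, a * ψ t + b * φ t = c * ψ t + d * φ t) : a = c ∧ b = d := by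
  have key : ∀ t, (a - c) * ψ t + (b - d) * φ t = 0 := fun t => by linear_combination h t
  have h1 := wronskian_combination hψ hφ (p := fun _ => 0) (q := φ) (c := 0) (d := 1)
    (fun t => (key t).symm) (fun t => by ring) t₀
  have h2 := wronskian_combination hψ hφ (p := ψ) (q := fun _ => 0) (a := 1) (b := 0)
    (fun t => by ring) (fun t => (key t).symm) t₀
  simp [wronskian] at h1 h2
  have hW' : ψ t₀ * deriv φ t₀ - deriv ψ t₀ * φ t₀ ≠ 0 := hW
  exact ⟨sub_eq_zero.1 (h1.resolve_right hW'), sub_eq_zero.1 (h2.resolve_right hW')⟩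

/-- ψ₋(-k) and ψ₊(-k) form a basis since their Wronskian is non-zero. Cramer's rule then exhibits
B(k) as a quotient whose numerator is the Wronskian in the second claim. -/
theorem existsUnique_isScatteringPair (hV : Integrable V volume) {k : ℂ} (hk : k.re = 0)
    (hk0 : k ≠ 0) : (∃! p, IsScatteringPair V k p) ∧
      (scatteringB V k = 0 ↔ wronskian (jostSolMinus V (-k)) (jostSol V k) 0 = 0) := by
  have him : (-k).im ≠ 0 := fun h => hk0 (Complex.ext hk (by simpa using h))
  have hk' : (-k).re = 0 := by simp [hk]
  have hn0 : -k ≠ 0 := neg_ne_zero.2 hk0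
  have hs := isSolution_jostSol hV hk.ge hk0
  have hs' := isSolution_jostSol hV hk'.ge hn0
  have hm' := isSolution_jostSolMinus hV hk'.ge hn0
  rw [neg_sq] at hs' hm'
  have hW : wronskian (jostSolMinus V (-k)) (jostSol V (-k)) 0 ≠ 0 := by
    rw [wronskian_swap, neg_ne_zero]
    exact wronskian_jostSol_jostSolMinus_ne_zero hV hk'.ge him
  have hc := hs.eq_combination hV.locallyIntegrable hm' hs' hW
  have hiff : ∀ p, IsScatteringPair V k p ↔ ∀ t, jostSol V k t =
      p.1 * jostSolMinus V (-k) t + p.2 * jostSol V (-k) t := fun p => by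
    rw [IsScatteringPair, jostPlus_eq hV hk hk0, jostPlus_eq hV hk' hn0, jostMinus_eq hV hk' hn0]
  have hex : IsScatteringPair V k (_, _) := (hiff (_, _)).2 hc
  have huniq : ∀ p, IsScatteringPair V k p →
      p = (wronskian (jostSol V k) (jostSol V (-k)) 0 /
          wronskian (jostSolMinus V (-k)) (jostSol V (-k)) 0,
        wronskian (jostSolMinus V (-k)) (jostSol V k) 0 /
          wronskian (jostSolMinus V (-k)) (jostSol V (-k)) 0) := fun p hp => by
    obtain ⟨h1, h2⟩ := coeff_eq_of_combination_eq hm'.1 hs'.1 hW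
      fun t => (((hiff p).1 hp) t).symm.trans (hc t)
    exact Prod.ext h1 h2
  refine ⟨⟨_, hex, huniq⟩, ?_⟩
  rw [scatteringB, huniq _ (Classical.epsilon_spec ⟨_, hex⟩)]
  simp [hW]

/-- A change of basis multiplies the antisymmetric numerator and the Wronskian by the same
determinant. -/
theorem isCanonicalBisolution_iff (hV : Integrable V volume) {k : ℂ} (hk : k.re = 0)
    (hk0 : k ≠ 0) (G : ℝ → ℝ → ℂ) : IsCanonicalBisolution V (-k ^ 2) G ↔
      G = fun t s => (jostSol V k t * jostSol V (-k) s - jostSol V (-k) t * jostSol V k s) /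
        (2 * k) := by
  have hk' : (-k).re = 0 := by simp [hk]
  have hn0 : -k ≠ 0 := neg_ne_zero.2 hk0
  have hs := isSolution_jostSol hV hk.ge hk0
  have hs' := isSolution_jostSol hV hk'.ge hn0
  rw [neg_sq] at hs'
  have h2k : 2 * k ≠ 0 := by simpa using hk0
  have hW := wronskian_jostSol_jostSol_neg hV hk hk0
  constructor
  · rintro ⟨ψ₁, ψ₂, w, h1, h2, hw, hww, hG⟩
    have c1 := h1.eq_combination hV.locallyIntegrable hs hs' (by rwa [hW])
    have c2 := h2.eq_combination hV.locallyIntegrable hs hs' (by rwa [hW])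
    have hw' := wronskian_combination hs.1 hs'.1 c1 c2 0
    rw [hww] at hw'
    funext t s
    rw [hG, c1 t, c1 s, c2 t, c2 s, div_eq_div_iff hw h2k, hw', hW]
    ring
  · rintro rfl
    exact ⟨_, _, 2 * k, hs, hs', h2k, hW, fun t s => rfl⟩

/-! ### Integral operators with exponentially decaying kernel -/

theorem integrable_exp_neg_mul_abs {κ : ℝ} (hκ : 0 < κ) :
    Integrable (fun x : ℝ => Real.exp (-κ * |x|)) volume := by
  have h1 : IntegrableOn (fun x : ℝ => Real.exp (-κ * |x|)) (Set.Ioi 0) volume :=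
    (exp_neg_integrableOn_Ioi 0 hκ).congr_fun
      (fun x hx => by simp only [abs_of_pos (Set.mem_Ioi.1 hx)]) measurableSet_Ioi
  have h2 : IntegrableOn (fun x : ℝ => Real.exp (-κ * |x|)) (Set.Iic 0) volume := by
    rw [integrableOn_Iic_iff_integrableOn_Iio]
    have h3 := ((Measure.measurePreserving_neg (volume : Measure ℝ)).integrableOn_comp_preimage
      (Homeomorph.neg ℝ).measurableEmbedding (f := fun x : ℝ => Real.exp (-κ * |x|))
      (s := Set.Ioi 0)).2 h1
    simpa [Function.comp_def] using h3
  rw [← integrableOn_univ, ← Set.Iic_union_Ioi (a := (0 : ℝ))]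
  exact h2.union h1

theorem lintegral_mul_sq_le {α : Type*} [MeasurableSpace α] {μ : Measure α} {f g : α → ENNReal}
    (hf : AEMeasurable f μ) (hg : AEMeasurable g μ) :
    (∫⁻ a, f a * g a ∂μ) ^ 2 ≤ (∫⁻ a, f a ^ 2 ∂μ) * ∫⁻ a, g a ^ 2 ∂μ := by
  have h := ENNReal.lintegral_mul_le_Lp_mul_Lq μ Real.HolderConjugate.two_two hf hg
  have h2 := pow_le_pow_left' h 2
  refine h2.trans_eq ?_
  rw [mul_pow]
  simp only [ENNReal.rpow_two]
  rw [← ENNReal.rpow_two, ← ENNReal.rpow_two, ← ENNReal.rpow_mul, ← ENNReal.rpow_mul]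
  norm_num

/-- The Schur test for convolution type kernels. -/
theorem lintegral_lintegral_exp_mul_sq_le {κ : ℝ} {g : ℝ → ENNReal} (hg : AEMeasurable g volume) :
    ∫⁻ t, (∫⁻ s, ENNReal.ofReal (Real.exp (-κ * |t - s|)) * g s) ^ 2 ≤
      (∫⁻ x : ℝ, ENNReal.ofReal (Real.exp (-κ * |x|))) ^ 2 * ∫⁻ s, g s ^ 2 := by
  set A := ∫⁻ x : ℝ, ENNReal.ofReal (Real.exp (-κ * |x|)) with hA
  have hsq : ∀ x : ℝ, ENNReal.ofReal (Real.exp (-(κ / 2) * |x|)) ^ 2 =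
      ENNReal.ofReal (Real.exp (-κ * |x|)) := fun x => by
    rw [← ENNReal.ofReal_pow (Real.exp_pos _).le, ← Real.exp_nat_mul]
    congr 2; push_cast; ring
  have h1 : ∀ t : ℝ, (∫⁻ s, ENNReal.ofReal (Real.exp (-κ * |t - s|)) * g s) ^ 2 ≤
      A * ∫⁻ s, ENNReal.ofReal (Real.exp (-κ * |t - s|)) * g s ^ 2 := fun t => by
    -- Cauchy–Schwarz with the kernel split evenly into two factors exp(-κ|t-s|/2).
    have h := lintegral_mul_sq_le (μ := volume)
      (f := fun s : ℝ => ENNReal.ofReal (Real.exp (-(κ / 2) * |t - s|)))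
      (g := fun s : ℝ => ENNReal.ofReal (Real.exp (-(κ / 2) * |t - s|)) * g s)
      (by fun_prop) (by fun_prop)
    simp only [← mul_assoc, ← pow_two, mul_pow, hsq] at h
    rwa [lintegral_sub_left_eq_self (fun x : ℝ => ENNReal.ofReal (Real.exp (-κ * |x|))) t] at h
  calc _ ≤ ∫⁻ t, A * ∫⁻ s, ENNReal.ofReal (Real.exp (-κ * |t - s|)) * g s ^ 2 :=
        lintegral_mono h1
    _ ≤ A * (A * ∫⁻ s, g s ^ 2) := by
        have hjm : AEMeasurable (fun p : ℝ × ℝ => ENNReal.ofReal (Real.exp (-κ * |p.1 - p.2|)) *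
            g p.2 ^ 2) (volume.prod volume) :=
          (by fun_prop : Measurable fun p : ℝ × ℝ =>
            ENNReal.ofReal (Real.exp (-κ * |p.1 - p.2|))).aemeasurable.mul
            ((hg.comp_quasiMeasurePreserving Measure.quasiMeasurePreserving_snd).pow_const 2)
        rw [lintegral_const_mul'' _ hjm.lintegral_prod_right', lintegral_lintegral_swap hjm]
        gcongr
        rw [← lintegral_const_mul'' _ (hg.pow_const 2)]
        refine lintegral_mono fun s => ?_
        dsimp only
        rw [lintegral_mul_const _ (by fun_prop),
          lintegral_sub_right_eq_self (fun x : ℝ => ENNReal.ofReal (Real.exp (-κ * |x|))) s]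
    _ = A ^ 2 * ∫⁻ s, g s ^ 2 := by ring

section DecayingKernel

variable {K : ℝ × ℝ → ℂ} {C κ : ℝ}

theorem memLp_of_norm_le_exp (hK : Continuous K) (hκ : 0 < κ)
    (hb : ∀ t s, ‖K (t, s)‖ ≤ C * Real.exp (-κ * |t - s|)) (t : ℝ) :
    MemLp (fun s => K (t, s)) 2 volume := by
  have hm : AEStronglyMeasurable (fun s => K (t, s)) volume :=
    (hK.comp (by fun_prop : Continuous fun s : ℝ => (t, s))).aestronglyMeasurable
  rw [memLp_two_iff_integrable_sq_norm hm]
  have hi := ((integrable_exp_neg_mul_abs (κ := 2 * κ) (by linarith)).comp_sub_left t).const_mul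
    (C ^ 2)
  refine hi.mono' (hm.norm.pow 2) (Eventually.of_forall fun s => ?_)
  rw [Real.norm_of_nonneg (by positivity)]
  refine (pow_le_pow_left₀ (norm_nonneg _) (hb t s) 2).trans_eq ?_
  rw [mul_pow, ← Real.exp_nat_mul]
  congr 2; push_cast; ring

theorem integrable_kernel_mul (hK : Continuous K) (hκ : 0 < κ)
    (hb : ∀ t s, ‖K (t, s)‖ ≤ C * Real.exp (-κ * |t - s|)) {g : ℝ → ℂ} (hg : MemLp g 2 volume)
    (t : ℝ) : Integrable (fun s => K (t, s) * g s) volume :=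
  (memLp_of_norm_le_exp hK hκ hb t).integrable_mul hg

theorem aestronglyMeasurable_kernel_integral (hK : Continuous K) {g : ℝ → ℂ}
    (hg : AEStronglyMeasurable g volume) :
    AEStronglyMeasurable (fun t => ∫ s, K (t, s) * g s) volume := by
  have : AEStronglyMeasurable (fun p : ℝ × ℝ => K p * g p.2) (volume.prod volume) :=
    hK.aestronglyMeasurable.mul
      (hg.comp_quasiMeasurePreserving Measure.quasiMeasurePreserving_snd)
  exact this.integral_prod_right'

theorem eLpNorm_kernel_integral_le (hC : 0 ≤ C)
    (hb : ∀ t s, ‖K (t, s)‖ ≤ C * Real.exp (-κ * |t - s|)) {g : ℝ → ℂ} (hg : MemLp g 2 volume) :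
    eLpNorm (fun t => ∫ s, K (t, s) * g s) 2 volume ≤
      ENNReal.ofReal C * (∫⁻ x : ℝ, ENNReal.ofReal (Real.exp (-κ * |x|))) *
        eLpNorm g 2 volume := by
  have h1 : ∀ t, ‖∫ s, K (t, s) * g s‖ₑ ≤
      ENNReal.ofReal C * ∫⁻ s, ENNReal.ofReal (Real.exp (-κ * |t - s|)) * ‖g s‖ₑ := fun t => by
    refine (enorm_integral_le_lintegral_enorm _).trans ?_
    rw [← lintegral_const_mul' _ _ ENNReal.ofReal_ne_top]
    refine lintegral_mono fun s => ?_
    rw [enorm_mul, ← mul_assoc, ← ENNReal.ofReal_mul hC]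
    gcongr
    rw [← ofReal_norm]
    exact ENNReal.ofReal_le_ofReal (hb t s)
  have h2 : ∫⁻ t, ‖∫ s, K (t, s) * g s‖ₑ ^ 2 ≤ (ENNReal.ofReal C *
      ∫⁻ x : ℝ, ENNReal.ofReal (Real.exp (-κ * |x|))) ^ 2 * ∫⁻ s, ‖g s‖ₑ ^ 2 := by
    calc _ ≤ ∫⁻ t, ENNReal.ofReal C ^ 2 *
          (∫⁻ s, ENNReal.ofReal (Real.exp (-κ * |t - s|)) * ‖g s‖ₑ) ^ 2 :=
          lintegral_mono fun t => by rw [← mul_pow]; exact pow_le_pow_left' (h1 t) 2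
      _ ≤ _ := by
          rw [lintegral_const_mul' _ _ (by simp), mul_pow, mul_assoc]
          gcongr
          exact lintegral_lintegral_exp_mul_sq_le hg.1.enorm
  rw [eLpNorm_eq_lintegral_rpow_enorm_toReal two_ne_zero ENNReal.ofNat_ne_top,
    eLpNorm_eq_lintegral_rpow_enorm_toReal two_ne_zero ENNReal.ofNat_ne_top]
  simp only [ENNReal.toReal_ofNat, ENNReal.rpow_two]
  refine (ENNReal.rpow_le_rpow h2 (by norm_num)).trans_eq ?_
  rw [ENNReal.mul_rpow_of_nonneg _ _ (by norm_num), ← ENNReal.rpow_two, ← ENNReal.rpow_mul]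
  norm_num

/-- The bounded operator on `L²(ℝ)` with exponentially decaying continuous kernel `K`. -/
theorem exists_kernel_operator (hK : Continuous K) (hC : 0 ≤ C) (hκ : 0 < κ)
    (hb : ∀ t s, ‖K (t, s)‖ ≤ C * Real.exp (-κ * |t - s|)) :
    ∃ R : L2 →L[ℂ] L2, ∀ g : L2, (R g : ℝ → ℂ) =ᵐ[volume] fun t => ∫ s, K (t, s) * g s := by
  set M := ENNReal.ofReal C * ∫⁻ x : ℝ, ENNReal.ofReal (Real.exp (-κ * |x|)) with hM
  have hMtop : M ≠ ⊤ := ENNReal.mul_ne_top ENNReal.ofReal_ne_top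
    (integrable_exp_neg_mul_abs hκ).lintegral_lt_top.ne
  have hmem : ∀ g : L2, MemLp (fun t => ∫ s, K (t, s) * g s) 2 volume := fun g =>
    ⟨aestronglyMeasurable_kernel_integral hK (Lp.memLp g).1,
      (eLpNorm_kernel_integral_le hC hb (Lp.memLp g)).trans_lt
        (ENNReal.mul_lt_top hMtop.lt_top (Lp.memLp g).2)⟩
  have hint : ∀ (g : L2) t, Integrable (fun s => K (t, s) * g s) volume := fun g t =>
    integrable_kernel_mul hK hκ hb (Lp.memLp g) t
  let R₀ : L2 →ₗ[ℂ] L2 :=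
    { toFun := fun g => (hmem g).toLp _
      map_add' := fun g h => by
        rw [← MemLp.toLp_add]
        refine MemLp.toLp_congr _ _ (Eventually.of_forall fun t => ?_)
        rw [Pi.add_apply, ← integral_add (hint g t) (hint h t)]
        refine integral_congr_ae ?_
        filter_upwards [Lp.coeFn_add g h] with s hs
        rw [hs, Pi.add_apply, mul_add]
      map_smul' := fun c g => by
        rw [RingHom.id_apply, ← MemLp.toLp_const_smul]
        refine MemLp.toLp_congr _ _ (Eventually.of_forall fun t => ?_)
        rw [Pi.smul_apply, smul_eq_mul, ← integral_const_mul]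
        refine integral_congr_ae ?_
        filter_upwards [Lp.coeFn_smul c g] with s hs
        rw [hs, Pi.smul_apply, smul_eq_mul]; ring }
  refine ⟨R₀.mkContinuous M.toReal fun g => ?_, fun g => (hmem g).coeFn_toLp⟩
  change ‖(hmem g).toLp _‖ ≤ _
  rw [Lp.norm_toLp, Lp.norm_def, ← ENNReal.toReal_mul]
  exact ENNReal.toReal_mono (ENNReal.mul_ne_top hMtop (Lp.memLp g).2.ne)
    (eLpNorm_kernel_integral_le hC hb (Lp.memLp g))

end DecayingKernel

/-! ### The resolvent kernel -/

/-- The kernel `ψ₊(k, max t s) ψ₋(k, min t s) / W(ψ₊, ψ₋)`. -/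
def greenKernel (V : ℝ → ℝ) (k : ℂ) (p : ℝ × ℝ) : ℂ :=
  jostSol V k (max p.1 p.2) * jostSolMinus V k (min p.1 p.2) /
    wronskian (jostSol V k) (jostSolMinus V k) 0

theorem continuous_jostSol (hV : Integrable V volume) {k : ℂ} (hk : 0 ≤ k.re) (hk0 : k ≠ 0) :
    Continuous (jostSol V k) :=
  (isSolution_jostSol hV hk hk0).1.continuous

theorem continuous_jostSolMinus (hV : Integrable V volume) {k : ℂ} (hk : 0 ≤ k.re)
    (hk0 : k ≠ 0) : Continuous (jostSolMinus V k) :=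
  (isSolution_jostSolMinus hV hk hk0).1.continuous

theorem continuous_greenKernel (hV : Integrable V volume) {k : ℂ} (hk : 0 ≤ k.re) (hk0 : k ≠ 0) :
    Continuous (greenKernel V k) :=
  (((continuous_jostSol hV hk hk0).comp (by fun_prop)).mul
    ((continuous_jostSolMinus hV hk hk0).comp (by fun_prop))).div_const _

/-- The exponential factors exp(-k max) and exp(k min) have product of modulus exp(-Re k |t-s|). For
Re k > 0 this is off-diagonal decay; on the imaginary axis it remains a uniform bound. -/
theorem norm_greenKernel_le (hV : Integrable V volume) {δ : ℝ} (hδ : 0 < δ) {k : ℂ}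
    (hk : k ∈ paramSet δ) (t s : ℝ) : ‖greenKernel V k (t, s)‖ ≤
      jostBound V δ * jostBound (fun t => V (-t)) δ /
        ‖wronskian (jostSol V k) (jostSolMinus V k) 0‖ * Real.exp (-k.re * |t - s|) := by
  have h1 := norm_jostFactor_le hV hδ hk (max t s)
  have h2 := norm_jostFactor_le hV.comp_neg hδ hk (-min t s)
  have he : Real.exp (-k.re * |t - s|) = ‖Complex.exp (-k * (max t s : ℝ))‖ *
      ‖Complex.exp (-k * (-min t s : ℝ))‖ := by
    rw [Complex.norm_exp, Complex.norm_exp, ← Real.exp_add, abs_sub_comm, ← max_sub_min_eq_abs]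
    congr 1
    simp only [Complex.re_mul_ofReal, Complex.neg_re]
    ring
  rw [greenKernel, jostSol, jostSolMinus, jostSol, norm_div, norm_mul, norm_mul, norm_mul, he]
  have hB := (norm_nonneg _).trans h1
  calc _ = ‖jostFactor V k (max t s)‖ * ‖jostFactor (fun t => V (-t)) k (-min t s)‖ /
        ‖wronskian (jostSol V k) (jostSolMinus V k) 0‖ * (‖Complex.exp (-k * (max t s : ℝ))‖ *
      ‖Complex.exp (-k * (-min t s : ℝ))‖) := by ring
    _ ≤ _ := by gcongr

theorem greenKernel_of_le {t s : ℝ} (V : ℝ → ℝ) (k : ℂ) (h : s ≤ t) : greenKernel V k (t, s) =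
    jostSol V k t * jostSolMinus V k s / wronskian (jostSol V k) (jostSolMinus V k) 0 := by
  simp [greenKernel, max_eq_left h, min_eq_right h]

theorem greenKernel_of_ge {t s : ℝ} (V : ℝ → ℝ) (k : ℂ) (h : t ≤ s) : greenKernel V k (t, s) =
    jostSol V k s * jostSolMinus V k t / wronskian (jostSol V k) (jostSolMinus V k) 0 := by
  simp [greenKernel, max_eq_right h, min_eq_left h]

theorem jostSolMinus_ne_zero (hV : Integrable V volume) {k : ℂ} (hk : 0 ≤ k.re)
    (hk1 : k.im ≠ 0) (t : ℝ) : jostSolMinus V k t ≠ 0 :=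
  jostSol_ne_zero hV.comp_neg hk hk1 _

/-- The function `∫ G(t, s) g(s) ds` solves the inhomogeneous equation. -/
theorem integral_greenKernel_mul_isPrimitive (hV : Integrable V volume) {k : ℂ} (hk : 0 ≤ k.re)
    (hk1 : k.im ≠ 0) {g : ℝ → ℂ} (hg : LocallyIntegrable g volume)
    (hi : ∀ t, Integrable (fun s => greenKernel V k (t, s) * g s) volume) :
    ∃ χ, IsPrimitive (fun t => ∫ s, greenKernel V k (t, s) * g s) χ ∧
      IsPrimitive χ (fun t => ((V t : ℂ) - -k ^ 2) * (∫ s, greenKernel V k (t, s) * g s) - g t) := by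
  have hk0 : k ≠ 0 := fun h => hk1 (by simp [h])
  have hw := wronskian_jostSol_jostSolMinus_ne_zero hV hk hk1
  have hs := isSolution_jostSol hV hk hk0
  have hm := isSolution_jostSolMinus hV hk hk0
  have hww := fun t => hs.wronskian_eq hV.locallyIntegrable hm t 0
  obtain ⟨p1, p2⟩ := hs.isPrimitive hV.locallyIntegrable
  obtain ⟨q1, q2⟩ := hm.isPrimitive hV.locallyIntegrable
  -- Integrability of each factor on its half-line is recovered from that of G(t,·)g by dividing by
  -- a Jost solution at t, which never vanishes.
  have hb : ∀ t, IntegrableOn (fun s => jostSol V k s * g s) (Set.Ioi t) volume := fun t => by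
    refine IntegrableOn.congr_fun (((hi t).const_mul
      (wronskian (jostSol V k) (jostSolMinus V k) 0 / jostSolMinus V k t)).integrableOn)
      (fun s hs => ?_) measurableSet_Ioi
    have := jostSolMinus_ne_zero hV hk hk1 t
    simp only [greenKernel_of_ge V k (Set.mem_Ioi.1 hs).le]
    field_simp
  have ha : ∀ t, IntegrableOn (fun s => jostSolMinus V k s * g s) (Set.Iic t) volume := fun t => by
    refine IntegrableOn.congr_fun (((hi t).const_mul
      (wronskian (jostSol V k) (jostSolMinus V k) 0 / jostSol V k t)).integrableOn)
      (fun s hs => ?_) measurableSet_Iic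
    have := jostSol_ne_zero hV hk hk1 t
    simp only [greenKernel_of_le V k (Set.mem_Iic.1 hs)]
    field_simp
  have hB := IsPrimitive.setIntegral_Ioi
    (LocallyIntegrable.continuous_mul hg p1.continuous) hb
  have hA := IsPrimitive.setIntegral_Iic
    (LocallyIntegrable.continuous_mul hg q1.continuous) ha
  have hf : ∀ t, ∫ s, greenKernel V k (t, s) * g s =
      1 / wronskian (jostSol V k) (jostSolMinus V k) 0 *
      (jostSol V k t * (∫ s in Set.Iic t, jostSolMinus V k s * g s) +
        jostSolMinus V k t * ∫ s in Set.Ioi t, jostSol V k s * g s) := fun t => by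
    have e1 : ∫ s in Set.Iic t, greenKernel V k (t, s) * g s = jostSol V k t /
        wronskian (jostSol V k) (jostSolMinus V k) 0 *
          ∫ s in Set.Iic t, jostSolMinus V k s * g s := by
      rw [← integral_const_mul]
      refine setIntegral_congr_fun measurableSet_Iic fun s hs => ?_
      simp only [greenKernel_of_le V k (Set.mem_Iic.1 hs)]
      ring
    have e2 : ∫ s in Set.Ioi t, greenKernel V k (t, s) * g s = jostSolMinus V k t /
        wronskian (jostSol V k) (jostSolMinus V k) 0 *
          ∫ s in Set.Ioi t, jostSol V k s * g s := by
      rw [← integral_const_mul]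
      refine setIntegral_congr_fun measurableSet_Ioi fun s hs => ?_
      simp only [greenKernel_of_ge V k (Set.mem_Ioi.1 hs).le]
      ring
    rw [← intervalIntegral.integral_Iic_add_Ioi (hi t).integrableOn (hi t).integrableOn, e1, e2]
    ring
  refine ⟨_, (((p1.mul hA).add (q1.mul hB)).const_mul
    (1 / wronskian (jostSol V k) (jostSolMinus V k) 0)).congr (fun t => (hf t).symm)
    (fun t => ?_), (((p2.mul hA).add (q2.mul hB)).const_mul
    (1 / wronskian (jostSol V k) (jostSolMinus V k) 0)).congr (fun t => rfl) (fun t => ?_)⟩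
  · ring
  · rw [hf t]
    have := hww t
    rw [wronskian] at this
    field_simp
    -- The constant Wronskian turns the terms from differentiating the two integrals into the source
    -- -g.
    linear_combination -g t * this

/-! ### Square integrable solutions and the resolvent -/

theorem not_integrable_of_one_le_norm {f : ℝ → ℂ} (hf : Integrable f volume) :
    ¬ ∀ᶠ t in atTop, 1 ≤ ‖f t‖ := by
  intro h
  obtain ⟨T, hT⟩ := eventually_atTop.1 h
  have h1 : IntegrableOn (fun _ : ℝ => (1 : ℝ)) (Set.Ioi T) volume := by
    refine Integrable.mono hf.integrableOn (by fun_prop) ?_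
    filter_upwards [ae_restrict_mem measurableSet_Ioi] with t ht
    simpa using hT t (Set.mem_Ioi.1 ht).le
  simp [integrableOn_const_iff] at h1

/-- A square integrable solution has vanishing Wronskian with the decaying Jost solution. -/
theorem wronskian_jostSol_eq_zero_of_memLp (hV : Integrable V volume) {k : ℂ} (hk : 0 < k.re)
    {u : ℝ → ℂ} (hu : IsSolution V (-k ^ 2) u) (hu2 : MemLp u 2 volume) :
    wronskian u (jostSol V k) 0 = 0 := by
  have hk0 : k ≠ 0 := fun h => by simp [h] at hk
  have hs := isSolution_jostSol hV hk.le hk0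
  obtain ⟨p1, p2⟩ := hs.isPrimitive hV.locallyIntegrable
  obtain ⟨q1, q2⟩ := hu.isPrimitive hV.locallyIntegrable
  -- The Jost solution and its derivative decay exponentially, so their products with u are
  -- integrable. Nothing is known about the size of u', so it is eliminated below.
  have hdecay : ∀ {h : ℝ → ℂ} {C : ℝ}, Continuous h → (∀ t, ‖h t‖ ≤ C) →
      IntegrableOn (fun t => u t * (Complex.exp (-k * t) * h t)) (Set.Ioi 0) volume := by
    intro h C hc hC
    have hm : MemLp (fun t : ℝ => Complex.exp (-k * t) * h t) 2
        (volume.restrict (Set.Ioi 0)) := by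
      have hcont : Continuous fun t : ℝ => Complex.exp (-k * t) * h t := by fun_prop
      rw [memLp_two_iff_integrable_sq_norm hcont.aestronglyMeasurable]
      refine ((exp_neg_integrableOn_Ioi 0 (b := 2 * k.re) (by linarith)).const_mul (C ^ 2)).mono'
        (by fun_prop) (Eventually.of_forall fun t => ?_)
      have h1 : (-k * t).re = -k.re * t := by simp
      rw [norm_mul, Complex.norm_exp, h1, Real.norm_of_nonneg (by positivity), mul_pow,
        ← Real.exp_nat_mul, mul_comm]
      have h2 : ((2 : ℕ) : ℝ) * (-k.re * t) = -(2 * k.re) * t := by push_cast; ring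
      rw [h2]
      gcongr
      exact hC t
    exact (hu2.restrict _).integrable_mul hm
  obtain ⟨C', hC'⟩ := exists_norm_jostDerivFactor_le hV hk.le hk0
  have hC := norm_jostFactor_le hV (norm_pos_iff.2 hk0) (mem_paramSet_norm hk.le)
  have hI1 : IntegrableOn (fun t => u t * jostSol V k t) (Set.Ioi 0) volume :=
    hdecay (continuous_jostFactor hV hk.le hk0) hC
  have hDc : Continuous (jostDerivFactor V k) := by
    have h1 : jostDerivFactor V k = fun t : ℝ => Complex.exp (k * t) * deriv (jostSol V k) t := by
      funext t
      rw [deriv_jostSol hV hk.le hk0, ← mul_assoc, ← Complex.exp_add]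
      simp
    rw [h1]
    exact (by fun_prop : Continuous fun t : ℝ => Complex.exp (k * t)).mul p2.continuous
  have hI2 : IntegrableOn (fun t => u t * deriv (jostSol V k) t) (Set.Ioi 0) volume := by
    simp only [deriv_jostSol hV hk.le hk0]
    exact hdecay hDc hC'
  by_contra hw
  have hww := fun t => hu.wronskian_eq hV.locallyIntegrable hs t 0
  set w := wronskian u (jostSol V k) 0 with hwdef
  -- Substituting u'ψ = uψ' - w gives (uψ)' = 2uψ' - w. Since uψ' is integrable, a non-zero w makes
  -- uψ grow linearly, contradicting the integrability of uψ.
  have hid : ∀ T : ℝ, u T * jostSol V k T = u 0 * jostSol V k 0 +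
      2 * (∫ t in (0 : ℝ)..T, u t * deriv (jostSol V k) t) - w * T := fun T => by
    have h1 := (q1.mul p1).sub_eq 0 T
    have h2 : ∀ t, deriv u t * jostSol V k t + u t * deriv (jostSol V k) t =
        2 * (u t * deriv (jostSol V k) t) - w := fun t => by
      have := hww t
      rw [wronskian] at this
      linear_combination -this
    simp only [h2] at h1
    have hc : Continuous fun t => 2 * (u t * deriv (jostSol V k) t) :=
      continuous_const.mul (q1.continuous.mul p2.continuous)
    rw [intervalIntegral.integral_sub (hc.intervalIntegrable _ _) (by simp), intervalIntegral.integral_const_mul,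
      intervalIntegral.integral_const, sub_zero, Complex.real_smul] at h1
    linear_combination h1
  have hnorm : ∀ T : ℝ, 0 ≤ T → ‖w‖ * T - (‖u 0 * jostSol V k 0‖ +
      2 * ∫ t in Set.Ioi (0 : ℝ), ‖u t * deriv (jostSol V k) t‖) ≤ ‖u T * jostSol V k T‖ := by
    intro T hT
    have h1 : ‖∫ t in (0 : ℝ)..T, u t * deriv (jostSol V k) t‖ ≤
        ∫ t in Set.Ioi (0 : ℝ), ‖u t * deriv (jostSol V k) t‖ := by
      refine (intervalIntegral.norm_integral_le_integral_norm hT).trans ?_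
      rw [intervalIntegral.integral_of_le hT]
      exact setIntegral_mono_set hI2.norm (Eventually.of_forall fun _ => norm_nonneg _)
        (Eventually.of_forall fun _ h => h.1)
    have h2 : w * T = u 0 * jostSol V k 0 +
      2 * (∫ t in (0 : ℝ)..T, u t * deriv (jostSol V k) t) - u T * jostSol V k T := by
      rw [hid T]; ring
    have h3 : ‖w‖ * T = ‖w * T‖ := by simp [abs_of_nonneg hT]
    have h4 := (norm_sub_le (u 0 * jostSol V k 0 +
      2 * (∫ t in (0 : ℝ)..T, u t * deriv (jostSol V k) t)) (u T * jostSol V k T)).trans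
      (add_le_add_left (norm_add_le _ _) _)
    rw [← h2, ← h3, norm_mul (2 : ℂ), Complex.norm_ofNat] at h4
    linarith
  have hlim : Tendsto (fun T : ℝ => ‖w‖ * T - (‖u 0 * jostSol V k 0‖ +
      2 * ∫ t in Set.Ioi (0 : ℝ), ‖u t * deriv (jostSol V k) t‖)) atTop atTop :=
    tendsto_atTop_add_const_right _ _ (tendsto_id.const_mul_atTop (norm_pos_iff.2 hw))
  refine not_integrable_of_one_le_norm ((integrable_indicator_iff measurableSet_Ioi).2 hI1) ?_
  filter_upwards [hlim.eventually_ge_atTop 1, eventually_gt_atTop 0] with T h1 h2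
  rw [Set.indicator_of_mem (Set.mem_Ioi.2 h2)]
  exact h1.trans (hnorm T h2.le)

theorem _root_.MeasureTheory.MemLp.comp_neg_real {u : ℝ → ℂ} (h : MemLp u 2 volume) :
    MemLp (fun t => u (-t)) 2 volume :=
  h.comp_measurePreserving (Measure.measurePreserving_neg (volume : Measure ℝ))

/-- Square integrability at each end kills the Wronskian with the Jost solution decaying there.
These two solutions form a basis, so all coefficients of u vanish. -/
theorem IsSolution.eq_zero_of_memLp (hV : Integrable V volume) {k : ℂ} (hk : 0 < k.re)
    (hk1 : k.im ≠ 0) {u : ℝ → ℂ} (hu : IsSolution V (-k ^ 2) u) (hu2 : MemLp u 2 volume) (t : ℝ) :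
    u t = 0 := by
  have hk0 : k ≠ 0 := fun h => by simp [h] at hk
  have hw := wronskian_jostSol_jostSolMinus_ne_zero hV hk.le hk1
  have h1 := wronskian_jostSol_eq_zero_of_memLp hV hk hu hu2
  have h2 := wronskian_jostSol_eq_zero_of_memLp hV.comp_neg hk hu.comp_neg hu2.comp_neg_real
  have h3 : wronskian u (jostSolMinus V k) 0 = 0 := by
    have := wronskian_comp_neg (fun t => u (-t)) (jostSol (fun t => V (-t)) k) 0
    rw [neg_zero, h2, neg_zero] at this
    simp only [neg_neg] at this
    exact this
  have := hu.eq_combination hV.locallyIntegrable (isSolution_jostSol hV hk.le hk0)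
    (isSolution_jostSolMinus hV hk.le hk0) hw t
  rw [wronskian_swap u (jostSol V k), h1, h3] at this
  simpa using this

theorem locallyIntegrable_Lp (g : L2) : LocallyIntegrable (g : ℝ → ℂ) volume :=
  (Lp.memLp g).locallyIntegrable one_le_two

/-- The operator with kernel `greenKernel V k` is the resolvent at `-k²`. -/
theorem isResolventKernel_greenKernel (hV : Integrable V volume) {k : ℂ} (hk : 0 < k.re)
    (hk1 : k.im ≠ 0) : IsResolventKernel V (-k ^ 2) (greenKernel V k) := by
  have hk0 : k ≠ 0 := fun h => by simp [h] at hk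
  have hK := continuous_greenKernel hV hk.le hk0
  have hb := norm_greenKernel_le hV (norm_pos_iff.2 hk0) (mem_paramSet_norm hk.le)
  have hC := nonneg_of_mul_nonneg_left ((norm_nonneg _).trans (hb 0 0)) (Real.exp_pos _)
  obtain ⟨R, hR⟩ := exists_kernel_operator hK hC hk hb
  have hi := fun (g : L2) t => integrable_kernel_mul hK hk hb (Lp.memLp g) t
  refine ⟨hK.locallyIntegrable, R, fun g u => ?_, fun g => ?_⟩
  · obtain ⟨χ, h1, h2⟩ := integral_greenKernel_mul_isPrimitive hV hk.le hk1
      (locallyIntegrable_Lp g) (hi g)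
    have hd : ∀ x, HasDerivAt (fun t => ∫ s, greenKernel V k (t, s) * g s) (χ x) x :=
      fun x => h1.hasDerivAt h2.continuous x
    have hχ : deriv (fun t => ∫ s, greenKernel V k (t, s) * g s) = χ :=
      funext fun x => (hd x).deriv
    constructor
    · rintro rfl
      refine ⟨_, hR g, fun x => (hd x).differentiableAt, fun a b => ?_⟩
      rw [hχ, h2.sub_eq]
      refine intervalIntegral.integral_congr_ae ?_
      filter_upwards [hR g, Lp.coeFn_add (-k ^ 2 • R g) g, Lp.coeFn_smul (-k ^ 2) (R g)]
        with t e1 e2 e3 _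
      rw [e2, Pi.add_apply, e3, Pi.smul_apply, e1, smul_eq_mul]
      ring
    · rintro ⟨f, hf, hfd, hfe⟩
      have hw : LocallyIntegrable (fun t => (V t : ℂ) * f t -
          ((-k ^ 2 • u + g : L2) : ℝ → ℂ) t) volume :=
        ((hV.ofReal (𝕜 := ℂ)).locallyIntegrable.mul_continuous hfd.continuous).sub
          (locallyIntegrable_Lp _)
      obtain ⟨q1, q2⟩ := isPrimitive_deriv_of_sub_eq hfd hw hfe
      have q3 : IsPrimitive (deriv f) (fun t => ((V t : ℂ) - -k ^ 2) * f t - g t) := by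
        refine q2.congr_ae ?_
        filter_upwards [hf, Lp.coeFn_add (-k ^ 2 • u) g, Lp.coeFn_smul (-k ^ 2) u] with t e1 e2 e3
        rw [e2, Pi.add_apply, e3, Pi.smul_apply, e1, smul_eq_mul]
        ring
      have hsol := (IsSolution.of_isPrimitive (V := V) (z := -k ^ 2) (q1.sub h1)
        ((q3.sub h2).congr (fun _ => rfl) fun t => by ring)).1
      have hmem : MemLp (fun t => f t - ∫ s, greenKernel V k (t, s) * g s) 2 volume :=
        ((memLp_congr_ae hf).1 (Lp.memLp u)).sub ((memLp_congr_ae (hR g)).1 (Lp.memLp (R g)))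
      have h0 := hsol.eq_zero_of_memLp hV hk hk1 hmem
      refine Lp.ext ?_
      filter_upwards [hR g, hf] with t e1 e2
      rw [e1, e2]
      exact (sub_eq_zero.1 (h0 t)).symm
  · filter_upwards [hR g] with t ht
    exact ⟨hi g t, ht⟩

/-! ### Boundary values of the resolvent kernel -/

theorem integrable_testFunction_mul (φ : 𝓓((⊤ : Opens (ℝ × ℝ)), ℝ)) {F : ℝ × ℝ → ℂ}
    (hF : LocallyIntegrable F volume) : Integrable (fun p => (φ p : ℂ) * F p) volume :=
  hF.integrable_smul_left_of_hasCompactSupport φ.continuous φ.hasCompactSupport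

/-- Every locally integrable function defines a distribution. -/
theorem exists_isGivenBy {F : ℝ × ℝ → ℂ} (hF : LocallyIntegrable F volume) :
    ∃ T : Distrib2, IsGivenBy T F := by
  refine ⟨TestFunction.integralAgainstBilinCLM
    (ContinuousLinearMap.lsmul ℝ ℝ : ℝ →L[ℝ] ℂ →L[ℝ] ℂ) volume F, hF, fun φ => ?_⟩
  exact TestFunction.integralAgainstBilinCLM_eq_integral (hF.locallyIntegrableOn _)

/-- The primitive from 0 vanishes at all rationals, hence everywhere by continuity, and its
derivative is D almost everywhere. -/
theorem ae_eq_zero_of_forall_rat_setIntegral_eq_zero {D : ℝ → ℂ}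
    (hi : ∀ a b : ℚ, IntegrableOn D (Set.Ioc (a : ℝ) b) volume)
    (h0 : ∀ a b : ℚ, ∫ s in Set.Ioc (a : ℝ) b, D s = 0) : D =ᵐ[volume] 0 := by
  have hloc : LocallyIntegrable D volume := by
    rw [locallyIntegrable_iff]
    intro K hK
    obtain ⟨r, hr⟩ := hK.isBounded.subset_closedBall 0
    obtain ⟨a, ha⟩ := exists_rat_lt (-r)
    obtain ⟨b, hb⟩ := exists_rat_gt r
    refine (hi a b).mono_set fun x hx => ?_
    have := hr hx
    rw [Real.closedBall_eq_Icc] at this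
    exact ⟨by linarith [this.1], by linarith [this.2]⟩
  have hF := IsPrimitive.of_integral hloc 0
  have hzero : (fun x : ℝ => ∫ s in (0 : ℝ)..x, D s) = fun _ => 0 := by
    refine Continuous.ext_on (Rat.denseRange_cast (𝕜 := ℝ)) hF.continuous continuous_const ?_
    rintro _ ⟨q, rfl⟩
    have h1 := h0 0 q
    have h2 := h0 q 0
    rw [Rat.cast_zero] at h1 h2
    simp only [intervalIntegral, h1, h2, sub_zero]
  filter_upwards [hF.ae_hasDerivAt] with x hx
  rw [hzero] at hx
  exact hx.unique (hasDerivAt_const x 0)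

/-- The integral kernel of the resolvent is unique as a distribution. -/
theorem IsResolventKernel.integral_mul_eq {z : ℂ} {K K' : ℝ × ℝ → ℂ}
    (h : IsResolventKernel V z K) (h' : IsResolventKernel V z K')
    (φ : 𝓓((⊤ : Opens (ℝ × ℝ)), ℝ)) :
    ∫ p : ℝ × ℝ, (φ p : ℂ) * K p = ∫ p : ℝ × ℝ, (φ p : ℂ) * K' p := by
  obtain ⟨hK, R, hR, hRK⟩ := h
  obtain ⟨hK', R', hR', hRK'⟩ := h'
  have hRR : ∀ g, R' g = R g := fun g => (hR' g (R g)).2 ((hR g (R g)).1 rfl)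
  -- Testing on indicators of intervals with rational endpoints leaves countably many null sets, so
  -- a single exceptional set of t serves for all of them.
  have hae : ∀ᵐ t ∂(volume : Measure ℝ), ∀ a b : ℚ,
      IntegrableOn (fun s => K (t, s) - K' (t, s)) (Set.Ioc (a : ℝ) b) volume ∧
      ∫ s in Set.Ioc (a : ℝ) b, (K (t, s) - K' (t, s)) = 0 := by
    rw [ae_all_iff]; intro a
    rw [ae_all_iff]; intro b
    have hg : (indicatorConstLp 2 (μ := volume) (measurableSet_Ioc (a := (a : ℝ)) (b := b))
        measure_Ioc_lt_top.ne (1 : ℂ) : ℝ → ℂ) =ᵐ[volume] (Set.Ioc (a : ℝ) b).indicator fun _ => 1 :=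
      indicatorConstLp_coeFn
    filter_upwards [hRK (indicatorConstLp 2 measurableSet_Ioc measure_Ioc_lt_top.ne 1),
      hRK' (indicatorConstLp 2 measurableSet_Ioc measure_Ioc_lt_top.ne 1)] with t h1 h2
    have key : ∀ K : ℝ × ℝ → ℂ, (fun s => K (t, s) * (indicatorConstLp 2 (μ := volume)
        (measurableSet_Ioc (a := (a : ℝ)) (b := b)) measure_Ioc_lt_top.ne (1 : ℂ) : ℝ → ℂ) s)
        =ᵐ[volume] (Set.Ioc (a : ℝ) b).indicator fun s => K (t, s) := fun K => by
      filter_upwards [hg] with s hs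
      rw [hs]
      by_cases hsI : s ∈ Set.Ioc (a : ℝ) b <;> simp [hsI]
    have i1 := (integrable_indicator_iff measurableSet_Ioc).1 ((integrable_congr (key K)).1 h1.1)
    have i2 := (integrable_indicator_iff measurableSet_Ioc).1 ((integrable_congr (key K')).1 h2.1)
    refine ⟨i1.sub i2, ?_⟩
    rw [integral_sub i1 i2, ← integral_indicator measurableSet_Ioc,
      ← integral_indicator measurableSet_Ioc, ← integral_congr_ae (key K),
      ← integral_congr_ae (key K'), ← h1.2, ← h2.2, hRR, sub_self]
  have hi := integrable_testFunction_mul φ hK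
  have hi' := integrable_testFunction_mul φ hK'
  rw [Measure.volume_eq_prod] at hi hi' ⊢
  rw [integral_prod _ hi, integral_prod _ hi']
  refine integral_congr_ae ?_
  filter_upwards [hae] with t ht
  refine integral_congr_ae ?_
  filter_upwards [ae_eq_zero_of_forall_rat_setIntegral_eq_zero (fun a b => (ht a b).1)
    fun a b => (ht a b).2] with s hs
  rw [sub_eq_zero.1 hs]

theorem exists_neg_sq_eq {z : ℂ} (hz : z.im ≠ 0) :
    ∃ k : ℂ, -k ^ 2 = z ∧ 0 < k.re ∧ k.im ≠ 0 := by
  obtain ⟨k, hk⟩ := IsAlgClosed.exists_pow_nat_eq (-z) two_pos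
  have him : 2 * (k.re * k.im) = -z.im := by
    have := congrArg Complex.im hk
    simp only [pow_two, Complex.mul_im, Complex.neg_im] at this
    linarith
  have hne : k.re * k.im ≠ 0 := fun h => hz (by rw [h] at him; linarith)
  rcases lt_or_gt_of_ne (left_ne_zero_of_mul hne) with h | h
  · exact ⟨-k, by rw [neg_sq, hk, neg_neg], by simpa using h,
      by simpa using right_ne_zero_of_mul hne⟩
  · exact ⟨k, by rw [hk, neg_neg], h, right_ne_zero_of_mul hne⟩

/-- A square root of `-z` near the spectrum. -/
theorem norm_sub_le_of_neg_sq_eq {m σ ε : ℝ} (hm : 0 < m) (hσ : σ ^ 2 = 1) (hε : 0 < ε) {k : ℂ}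
    (hk : -k ^ 2 = ((m ^ 2 : ℝ) : ℂ) + Complex.I * σ * ε) (hre : 0 < k.re) :
    ‖k - -(Complex.I * σ * m)‖ ≤ ε / m := by
  -- With k₀ = -iσm the product (k - k₀)(k + k₀) = k² - k₀² has modulus ε. The second factor has
  -- modulus at least m, because Re k > 0 forces Im k and Im k₀ to have the same sign.
  have hprod : (k - -(Complex.I * σ * m)) * (k + -(Complex.I * σ * m)) = -(Complex.I * σ * ε) := by
    have h2 : ((σ : ℂ)) ^ 2 = 1 := by exact_mod_cast hσ
    push_cast at hk
    linear_combination -hk - (σ : ℂ) ^ 2 * m ^ 2 * Complex.I_sq + (m : ℂ) ^ 2 * h2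
  have hσ1 : |σ| = 1 := by
    rw [← sq_eq_sq₀ (abs_nonneg _) zero_le_one, sq_abs, hσ, one_pow]
  have him : 2 * (k.re * k.im) = -(σ * ε) := by
    have := congrArg Complex.im hk
    simp [pow_two] at this
    linarith
  have hneg : σ * k.im < 0 := by
    have h1 : 2 * k.re * (σ * k.im) = -ε := by
      calc _ = σ * (2 * (k.re * k.im)) := by ring
        _ = -(σ ^ 2 * ε) := by rw [him]; ring
        _ = -ε := by rw [hσ, one_mul]
    by_contra! hcon
    have := mul_nonneg (by linarith : (0 : ℝ) ≤ 2 * k.re) hcon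
    linarith
  have hlow : m ≤ ‖k + -(Complex.I * σ * m)‖ := by
    refine le_trans ?_ (Complex.abs_im_le_norm _)
    have h1 : (k + -(Complex.I * σ * m)).im = k.im - σ * m := by simp [sub_eq_add_neg]
    rw [h1, ← one_mul |k.im - σ * m|, ← hσ1, ← abs_mul, mul_sub, ← mul_assoc, ← pow_two, hσ]
    rw [one_mul, abs_of_neg (by linarith)]
    linarith
  have hn := congrArg norm hprod
  rw [norm_mul, norm_neg, norm_mul, norm_mul, Complex.norm_I, Complex.norm_real, Complex.norm_real,
    Real.norm_eq_abs, hσ1, Real.norm_of_nonneg hε.le, one_mul, one_mul] at hn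
  rw [le_div_iff₀ hm, ← hn]
  gcongr

theorem continuousOn_wronskian_jostSol (hV : Integrable V volume) {δ : ℝ} (hδ : 0 < δ) :
    ContinuousOn (fun k => wronskian (jostSol V k) (jostSolMinus V k) 0) (paramSet δ) := by
  have h : ContinuousOn (fun k => -(jostFactor V k 0 * jostDerivFactor (fun t => V (-t)) k 0) -
      jostDerivFactor V k 0 * jostFactor (fun t => V (-t)) k 0) (paramSet δ) :=
    ((continuousOn_jostFactor_param hV hδ 0).mul
      (continuousOn_jostDerivFactor_param hV.comp_neg hδ 0)).neg.sub
      ((continuousOn_jostDerivFactor_param hV hδ 0).mul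
      (continuousOn_jostFactor_param hV.comp_neg hδ 0))
  refine h.congr fun k hk => ?_
  have hk0 : k ≠ 0 := norm_pos_iff.1 (hδ.trans_le hk.2)
  rw [wronskian, deriv_jostSolMinus, jostSolMinus, neg_zero, deriv_jostSol hV hk.1 hk0,
    deriv_jostSol hV.comp_neg hk.1 hk0, jostSol, jostSol]
  simp

/-- Dominated convergence on the support of φ: the Jost bounds are uniform in |k| ≥ δ, and near k₀
the Wronskian stays above half its non-zero limiting modulus. -/
theorem tendsto_integral_greenKernel (hV : Integrable V volume) {δ : ℝ} (hδ : 0 < δ) {k₀ : ℂ}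
    (hk₀ : k₀ ∈ paramSet δ) (hk₁ : k₀.im ≠ 0) {l : Filter ℝ} [l.IsCountablyGenerated] {k : ℝ → ℂ}
    (hk : Tendsto k l (𝓝[paramSet δ] k₀)) (φ : 𝓓((⊤ : Opens (ℝ × ℝ)), ℝ)) :
    Tendsto (fun ε => ∫ p : ℝ × ℝ, (φ p : ℂ) * greenKernel V (k ε) p) l
      (𝓝 (∫ p : ℝ × ℝ, (φ p : ℂ) * greenKernel V k₀ p)) := by
  have hne : ∀ κ ∈ paramSet δ, κ ≠ 0 := fun κ hκ => norm_pos_iff.1 (hδ.trans_le hκ.2)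
  have hW := ((continuousOn_wronskian_jostSol hV hδ) k₀ hk₀).tendsto.comp hk
  have hW0 := wronskian_jostSol_jostSolMinus_ne_zero hV hk₀.1 hk₁
  set W := wronskian (jostSol V k₀) (jostSolMinus V k₀) 0 with hWdef
  set B := jostBound V δ * jostBound (fun t => V (-t)) δ with hB
  have hB0 : 0 ≤ B := mul_nonneg
    ((norm_nonneg _).trans (norm_jostFactor_le hV hδ hk₀ 0))
    ((norm_nonneg _).trans (norm_jostFactor_le hV.comp_neg hδ hk₀ 0))
  have hWn : 0 < ‖W‖ := norm_pos_iff.2 hW0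
  have hmem : ∀ᶠ ε in l, k ε ∈ paramSet δ := hk.eventually self_mem_nhdsWithin
  refine tendsto_integral_filter_of_dominated_convergence
    (fun p => |φ p| * (B / (‖W‖ / 2))) ?_ ?_ ?_ ?_
  · filter_upwards [hmem] with ε hε
    exact (integrable_testFunction_mul φ
      (continuous_greenKernel hV hε.1 (hne _ hε)).locallyIntegrable).1
  · filter_upwards [hmem, hW.norm.eventually (lt_mem_nhds (half_lt_self hWn))] with ε hε hWε
    refine Eventually.of_forall fun p => ?_
    rw [norm_mul, Complex.norm_real, Real.norm_eq_abs]
    gcongr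
    refine (norm_greenKernel_le hV hδ hε p.1 p.2).trans ?_
    have h1 : Real.exp (-(k ε).re * |p.1 - p.2|) ≤ 1 := by
      rw [Real.exp_le_one_iff, neg_mul, neg_nonpos]
      exact mul_nonneg hε.1 (abs_nonneg _)
    have hWε' : ‖W‖ / 2 ≤ ‖wronskian (jostSol V (k ε)) (jostSolMinus V (k ε)) 0‖ := hWε.le
    refine (mul_le_of_le_one_right (by positivity) h1).trans ?_
    gcongr
  · have h1 : Integrable φ volume := φ.continuous.integrable_of_hasCompactSupport
      φ.hasCompactSupport
    exact h1.abs.mul_const _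
  · refine Eventually.of_forall fun p => Tendsto.const_mul _ ?_
    have c1 : ContinuousOn (fun κ => jostSol V κ (max p.1 p.2)) (paramSet δ) :=
      (by fun_prop : Continuous fun κ : ℂ => Complex.exp (-κ * (max p.1 p.2 : ℝ))).continuousOn.mul
        (continuousOn_jostFactor_param hV hδ _)
    have c2 : ContinuousOn (fun κ => jostSolMinus V κ (min p.1 p.2)) (paramSet δ) :=
      (by fun_prop : Continuous fun κ : ℂ =>
        Complex.exp (-κ * (-min p.1 p.2 : ℝ))).continuousOn.mul
        (continuousOn_jostFactor_param hV.comp_neg hδ _)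
    exact (((c1 k₀ hk₀).tendsto.comp hk).mul ((c2 k₀ hk₀).tendsto.comp hk)).div hW hW0

/-- The boundary values of the resolvent exist and are given by the Green kernel of the Jost
solutions. -/
theorem isBoundaryValue_iff (hV : Integrable V volume) {m σ : ℝ} (hm : 0 < m) (hσ : σ ^ 2 = 1)
    (T : Distrib2) : IsBoundaryValue V (m ^ 2) σ T ↔
      IsGivenBy T (greenKernel V (-(Complex.I * σ * m))) := by
  have hσ0 : σ ≠ 0 := fun h => by simp [h] at hσ
  have hσ1 : |σ| = 1 := by
    rw [← sq_eq_sq₀ (abs_nonneg _) zero_le_one, sq_abs, hσ, one_pow]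
  have hre : (-(Complex.I * σ * m)).re = 0 := by simp
  have him : (-(Complex.I * σ * m)).im ≠ 0 := by simp [hσ0, hm.ne']
  -- The threshold m/2 lies strictly below |k₀| = m, so nearby parameters still belong to the set.
  have hk₀ : -(Complex.I * σ * m) ∈ paramSet (m / 2) := by
    refine ⟨hre.ge, ?_⟩
    rw [norm_neg, norm_mul, norm_mul, Complex.norm_I, Complex.norm_real, Complex.norm_real,
      Real.norm_eq_abs, hσ1, Real.norm_of_nonneg hm.le]
    linarith
  have hk₀0 : -(Complex.I * σ * m) ≠ 0 := fun h => him (by rw [h, Complex.zero_im])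
  have hloc : LocallyIntegrable (greenKernel V (-(Complex.I * σ * m))) volume :=
    (continuous_greenKernel hV hre.ge hk₀0).locallyIntegrable
  have hex : ∀ ε : ℝ, ∃ k : ℂ, 0 < ε → -k ^ 2 = ((m ^ 2 : ℝ) : ℂ) + Complex.I * σ * ε ∧
      0 < k.re ∧ k.im ≠ 0 := fun ε => by
    by_cases hε : 0 < ε
    · obtain ⟨k, hk⟩ := exists_neg_sq_eq (z := ((m ^ 2 : ℝ) : ℂ) + Complex.I * σ * ε)
        (by rw [Complex.add_im, Complex.ofReal_im]; simp [hσ0, hε.ne'])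
      exact ⟨k, fun _ => hk⟩
    · exact ⟨0, fun h => absurd h hε⟩
  choose k hk using hex
  have hker : ∀ ε : ℝ, 0 < ε →
      IsResolventKernel V (((m ^ 2 : ℝ) : ℂ) + Complex.I * σ * ε) (greenKernel V (k ε)) :=
    fun ε hε => by
      rw [← (hk ε hε).1]
      exact isResolventKernel_greenKernel hV (hk ε hε).2.1 (hk ε hε).2.2
  have hlim : Tendsto k (𝓝[>] 0) (𝓝 (-(Complex.I * σ * m))) := by
    rw [tendsto_iff_norm_sub_tendsto_zero]
    have h0 : Tendsto (fun ε : ℝ => ε / m) (𝓝[>] 0) (𝓝 0) := by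
      have : Tendsto (fun ε : ℝ => ε / m) (𝓝 0) (𝓝 (0 / m)) := tendsto_id.div_const m
      rw [zero_div] at this
      exact this.mono_left nhdsWithin_le_nhds
    refine squeeze_zero' (Eventually.of_forall fun _ => norm_nonneg _) ?_ h0
    filter_upwards [self_mem_nhdsWithin] with ε hε
    exact norm_sub_le_of_neg_sq_eq hm hσ hε (hk ε hε).1 (hk ε hε).2.1
  have hlim' : Tendsto k (𝓝[>] 0) (𝓝[paramSet (m / 2)] (-(Complex.I * σ * m))) := by
    refine tendsto_nhdsWithin_iff.2 ⟨hlim, ?_⟩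
    have hnorm : ‖-(Complex.I * σ * m)‖ = m := by
      rw [norm_neg, norm_mul, norm_mul, Complex.norm_I, Complex.norm_real, Complex.norm_real,
        Real.norm_eq_abs, hσ1, Real.norm_of_nonneg hm.le, one_mul, one_mul]
    filter_upwards [self_mem_nhdsWithin, hlim.norm.eventually
      (lt_mem_nhds (by rw [hnorm]; linarith : m / 2 < _))] with ε hε h2
    exact ⟨(hk ε hε).2.1.le, h2.le⟩
  have hconv := tendsto_integral_greenKernel hV (half_pos hm) hk₀ him hlim'
  constructor
  · rintro ⟨K, hK, hKlim⟩
    -- Any admissible family of resolvent kernels has the same pairings with test functions as the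
    -- Green kernels, so the limit does not depend on the family.
    refine ⟨hloc, fun φ => tendsto_nhds_unique (hKlim φ) ((hconv φ).congr' ?_)⟩
    filter_upwards [self_mem_nhdsWithin] with ε hε
    exact (hker ε hε).integral_mul_eq (hK ε hε) φ
  · rintro ⟨-, hT⟩
    exact ⟨fun ε => greenKernel V (k ε), hker, fun φ => by rw [hT φ]; exact hconv φ⟩

theorem IsGivenBy.unique {T T' : Distrib2} {F : ℝ × ℝ → ℂ} (h : IsGivenBy T F)
    (h' : IsGivenBy T' F) : T = T' := by
  ext φ
  rw [h.2, h'.2]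

theorem existsUnique_isBoundaryValue (hV : Integrable V volume) {m σ : ℝ} (hm : 0 < m)
    (hσ : σ ^ 2 = 1) : (∃! T : Distrib2, IsBoundaryValue V (m ^ 2) σ T) ∧
      IsGivenBy (boundaryValue V (m ^ 2) σ) (greenKernel V (-(Complex.I * σ * m))) := by
  have hσ0 : σ ≠ 0 := fun h => by simp [h] at hσ
  obtain ⟨T, hT⟩ := exists_isGivenBy (continuous_greenKernel hV
    (k := -(Complex.I * σ * m)) (by simp) (by simp [hσ0, hm.ne'])).locallyIntegrable
  have hB := (isBoundaryValue_iff hV hm hσ T).2 hT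
  exact ⟨⟨T, hB, fun T' hT' => ((isBoundaryValue_iff hV hm hσ T').1 hT').unique hT⟩,
    (isBoundaryValue_iff hV hm hσ _).1 (Classical.epsilon_spec ⟨T, hB⟩)⟩

theorem IsGivenBy.add {T T' : Distrib2} {F F' : ℝ × ℝ → ℂ} (h : IsGivenBy T F)
    (h' : IsGivenBy T' F') : IsGivenBy (T + T') (fun p => F p + F' p) := by
  refine ⟨h.1.add h'.1, fun φ => ?_⟩
  have : (T + T') φ = T φ + T' φ := rfl
  rw [this, h.2, h'.2, ← integral_add (integrable_testFunction_mul φ h.1)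
    (integrable_testFunction_mul φ h'.1)]
  simp only [mul_add]

/-- Equal pairings with all test functions give equality almost everywhere, and continuity upgrades
it to every point. -/
theorem IsGivenBy.isGivenBy_iff {T : Distrib2} {F F' : ℝ × ℝ → ℂ} (h : IsGivenBy T F)
    (hF : Continuous F) (hF' : Continuous F') : IsGivenBy T F' ↔ ∀ p, F p = F' p := by
  refine ⟨fun h' => ?_, fun heq => funext heq ▸ h⟩
  have hae : ∀ᵐ p ∂(volume : Measure (ℝ × ℝ)), F p = F' p := by
    refine ae_eq_of_integral_contDiff_smul_eq h.1 h'.1 fun g hg hgc => ?_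
    let φ : 𝓓((⊤ : Opens (ℝ × ℝ)), ℝ) := ⟨g, hg, hgc, fun _ _ => trivial⟩
    exact (h.2 φ).symm.trans (h'.2 φ)
  exact congrFun (Continuous.ae_eq_iff_eq volume hF hF' |>.1 hae)

/-! ### Reflectionless potentials and special Klein-Gordon equations -/

theorem greenKernel_add_eq_iff (hV : Integrable V volume) {k : ℂ} (hk : k.re = 0) (hk0 : k ≠ 0) :
    (∀ p : ℝ × ℝ, greenKernel V k p + greenKernel V (-k) p =
      (jostSol V k (max p.1 p.2) * jostSol V (-k) (min p.1 p.2) -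
        jostSol V (-k) (max p.1 p.2) * jostSol V k (min p.1 p.2)) / (2 * k)) ↔
      wronskian (jostSolMinus V (-k)) (jostSol V k) 0 = 0 ∧
        wronskian (jostSolMinus V k) (jostSol V (-k)) 0 = 0 := by
  have him : k.im ≠ 0 := fun h => hk0 (Complex.ext hk h)
  have him' : (-k).im ≠ 0 := by simpa using him
  have hk' : (-k).re = 0 := by simp [hk]
  have hn0 : -k ≠ 0 := neg_ne_zero.2 hk0
  have hP := isSolution_jostSol hV hk.ge hk0
  have hP' := isSolution_jostSol hV hk'.ge hn0
  have hQ := isSolution_jostSolMinus hV hk.ge hk0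
  have hQ' := isSolution_jostSolMinus hV hk'.ge hn0
  rw [neg_sq] at hP' hQ'
  have hW := wronskian_jostSol_jostSol_neg hV hk hk0 0
  have h2k : 2 * k ≠ 0 := by simpa using hk0
  have hW0 : wronskian (jostSol V k) (jostSol V (-k)) 0 ≠ 0 := by rwa [hW]
  have hb := wronskian_jostSol_jostSolMinus_ne_zero hV hk.ge him
  have ha' := wronskian_jostSol_jostSolMinus_ne_zero hV hk'.ge him'
  have cQ := hQ.eq_combination hV.locallyIntegrable hP hP' hW0
  have cQ' := hQ'.eq_combination hV.locallyIntegrable hP hP' hW0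
  rw [hW, wronskian_swap (jostSol V (-k)) (jostSolMinus V (-k))] at cQ'
  rw [wronskian_swap (jostSol V k) (jostSolMinus V (-k))]
  rw [hW] at cQ
  have hP0 := jostSol_ne_zero hV hk.ge him 0
  have hP0' := jostSol_ne_zero hV hk'.ge him' 0
  -- In ψ₋(k) the coefficient of ψ₊(-k) is W(ψ₊(k),ψ₋(k))/(2k), which cancels the denominator of the
  -- Green kernel and leaves 1/(2k). The same happens with -k in place of k, with the opposite sign.
  -- Only the two diagonal products depend on the potential through their coefficients.
  have key : ∀ x y : ℝ, jostSol V k x * jostSolMinus V k y /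
        wronskian (jostSol V k) (jostSolMinus V k) 0 +
      jostSol V (-k) x * jostSolMinus V (-k) y /
        wronskian (jostSol V (-k)) (jostSolMinus V (-k)) 0 =
      (jostSol V k x * jostSol V (-k) y - jostSol V (-k) x * jostSol V k y) / (2 * k) +
      (wronskian (jostSolMinus V k) (jostSol V (-k)) 0 /
        wronskian (jostSol V k) (jostSolMinus V k) 0 * jostSol V k x * jostSol V k y +
      wronskian (jostSol V k) (jostSolMinus V (-k)) 0 /
        wronskian (jostSol V (-k)) (jostSolMinus V (-k)) 0 *
          jostSol V (-k) x * jostSol V (-k) y) / (2 * k) := fun x y => by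
    rw [cQ y, cQ' y]
    field_simp
    ring
  simp only [greenKernel, key, add_eq_left, neg_eq_zero]
  constructor
  · intro h
    -- One variable is frozen at 0. The remainder is symmetric in its two arguments, so the order of
    -- t and 0 is immaterial; linear independence and the non-vanishing of Jost solutions at 0 then
    -- isolate the coefficients.
    have h0 : ∀ t : ℝ, wronskian (jostSolMinus V k) (jostSol V (-k)) 0 /
          wronskian (jostSol V k) (jostSolMinus V k) 0 * jostSol V k 0 * jostSol V k t +
        wronskian (jostSol V k) (jostSolMinus V (-k)) 0 /
          wronskian (jostSol V (-k)) (jostSolMinus V (-k)) 0 *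
            jostSol V (-k) 0 * jostSol V (-k) t = 0 * jostSol V k t + 0 * jostSol V (-k) t := by
      intro t
      have h1 := (div_eq_zero_iff.1 (h (t, 0))).resolve_right h2k
      rw [zero_mul, zero_mul, zero_add]
      rcases le_total t 0 with ht | ht
      · simpa only [max_eq_right ht, min_eq_left ht] using h1
      · simp only [max_eq_left ht, min_eq_right ht] at h1
        linear_combination h1
    obtain ⟨h1, h2⟩ := coeff_eq_of_combination_eq hP.1 hP'.1 hW0 h0
    simp [hP0, hP0', hb, ha'] at h1 h2
    exact ⟨h2, h1⟩
  · rintro ⟨h1, h2⟩ p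
    simp [h1, h2]

/-- Antisymmetry turns the minus sign of the backward function into an exchange of arguments. On the
diagonal both Heaviside factors equal 1, which is harmless since the bisolution vanishes there. -/
theorem forwardGreen_add_backwardGreen (V : ℝ → ℝ) (z : ℂ)
    (h : ∀ t s, canonicalBisolution V z t s = -canonicalBisolution V z s t) (t s : ℝ) :
    forwardGreen V z t s + backwardGreen V z t s =
      canonicalBisolution V z (max t s) (min t s) := by
  rcases lt_trichotomy t s with hts | rfl | hts
  · simp [forwardGreen, backwardGreen, heaviside, hts.le, not_le.2 hts, h s t]
  · have h0 : canonicalBisolution V z t t = 0 := self_eq_neg.1 (h t t)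
    simp [forwardGreen, backwardGreen, h0]
  · simp [forwardGreen, backwardGreen, heaviside, hts.le, not_le.2 hts]

theorem isReflectionless_iff_isSpecial (hV : Integrable V volume) {m : ℝ} (hm : 0 < m) :
    IsReflectionless V m ↔ IsSpecial V m := by
  have hk : (Complex.I * (m : ℂ)).re = 0 := by simp
  have hk0 : Complex.I * (m : ℂ) ≠ 0 := by simp [hm.ne']
  have hk' : (-(Complex.I * (m : ℂ))).re = 0 := by simp
  have hn0 : -(Complex.I * (m : ℂ)) ≠ 0 := neg_ne_zero.2 hk0
  have hz : (m : ℂ) ^ 2 = -(Complex.I * m) ^ 2 := by rw [mul_pow, Complex.I_sq]; ring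
  have hG : canonicalBisolution V ((m : ℂ) ^ 2) = _ :=
    (isCanonicalBisolution_iff hV hk hk0 _).1 (by
      rw [hz]
      exact Classical.epsilon_spec ⟨_, (isCanonicalBisolution_iff hV hk hk0 _).2 rfl⟩)
  have hplus := (existsUnique_isBoundaryValue hV hm (σ := 1) (by norm_num)).2
  have hminus := (existsUnique_isBoundaryValue hV hm (σ := -1) (by norm_num)).2
  -- The root with non-negative real part tends to -im from above the spectrum and to im from below.
  have e1 : -(Complex.I * ((1 : ℝ) : ℂ) * m) = -(Complex.I * m) := by simp
  have e2 : -(Complex.I * ((-1 : ℝ) : ℂ) * m) = Complex.I * m := by simp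
  rw [e1] at hplus
  rw [e2] at hminus
  have hF : (fun p : ℝ × ℝ => forwardGreen V ((m : ℂ) ^ 2) p.1 p.2 +
      backwardGreen V ((m : ℂ) ^ 2) p.1 p.2) = fun p : ℝ × ℝ =>
      (jostSol V (Complex.I * m) (max p.1 p.2) * jostSol V (-(Complex.I * m)) (min p.1 p.2) -
        jostSol V (-(Complex.I * m)) (max p.1 p.2) * jostSol V (Complex.I * m) (min p.1 p.2)) /
        (2 * (Complex.I * m)) := by
    funext p
    rw [forwardGreen_add_backwardGreen, hG]
    intro t s
    rw [hG]; ring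
  have hP := continuous_jostSol hV hk.ge hk0
  have hP' := continuous_jostSol hV hk'.ge hn0
  rw [IsSpecial, hF, (hminus.add hplus).isGivenBy_iff
    ((continuous_greenKernel hV hk.ge hk0).add (continuous_greenKernel hV hk'.ge hn0))
    (by fun_prop), greenKernel_add_eq_iff hV hk hk0, IsReflectionless,
    (existsUnique_isScatteringPair hV hk hk0).2, (existsUnique_isScatteringPair hV hk' hn0).2,
    neg_neg]

end KleinGordon1D

end

theorem mainTheorem4 (V : ℝ → ℝ) (hV : MeasureTheory.Integrable V MeasureTheory.volume)
    (m : ℝ) (hm : 0 < m) :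
    -- the Jost solutions and the scattering coefficients at `k = ± i m` are well defined
    (∀ k : ℂ, k = Complex.I * m ∨ k = -(Complex.I * m) →
      (∃! ψ : ℝ → ℂ, KleinGordon1D.IsJostPlus V k ψ) ∧
      (∃! ψ : ℝ → ℂ, KleinGordon1D.IsJostMinus V k ψ) ∧
      (∃! p : ℂ × ℂ, KleinGordon1D.IsScatteringPair V k p)) ∧
    -- so are the canonical bisolution and the boundary values `G(m² ∓ i0)` of the resolvent
    (∃! G : ℝ → ℝ → ℂ, KleinGordon1D.IsCanonicalBisolution V ((m : ℂ) ^ 2) G) ∧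
    (∃! T : KleinGordon1D.Distrib2, KleinGordon1D.IsBoundaryValue V (m ^ 2) (-1) T) ∧
    (∃! T : KleinGordon1D.Distrib2, KleinGordon1D.IsBoundaryValue V (m ^ 2) 1 T) ∧
    -- the potential is reflectionless at energy `m²` if and only if the equation is special
    (KleinGordon1D.IsReflectionless V m ↔ KleinGordon1D.IsSpecial V m) := by
  have hk : (Complex.I * (m : ℂ)).re = 0 := by simp
  have hk0 : Complex.I * (m : ℂ) ≠ 0 := by simp [hm.ne']
  refine ⟨fun k hkk => ?_, ?_,
    (KleinGordon1D.existsUnique_isBoundaryValue hV hm (by norm_num)).1,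
    (KleinGordon1D.existsUnique_isBoundaryValue hV hm (by norm_num)).1,
    KleinGordon1D.isReflectionless_iff_isSpecial hV hm⟩
  · have hre : k.re = 0 := by rcases hkk with rfl | rfl <;> simp
    have hne : k ≠ 0 := by
      rcases hkk with rfl | rfl
      · exact hk0
      · exact neg_ne_zero.2 hk0
    exact ⟨KleinGordon1D.existsUnique_isJostPlus hV hre hne,
      KleinGordon1D.existsUnique_isJostMinus hV hre hne,
      (KleinGordon1D.existsUnique_isScatteringPair hV hre hne).1⟩
  · have hz : (m : ℂ) ^ 2 = -(Complex.I * m) ^ 2 := by rw [mul_pow, Complex.I_sq]; ring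
    rw [hz]
    exact ⟨_, (KleinGordon1D.isCanonicalBisolution_iff hV hk hk0 _).2 rfl,
      fun G h => (KleinGordon1D.isCanonicalBisolution_iff hV hk hk0 G).1 h⟩
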